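/- **Notation.** For a finite graph $G=(V,E)$ and a (not necessarily proper) colouring $c:V\to\{1,\dots,k\}$ let $C(v)=\{c(u): uv\in E\}$. The colouring is a *set colouring* if $C(u)\ne C(v)$ for every edge $uv$; the *set chromatic number* $\chi_s(G)$ is the least $k$ for which $G$ has a set colouring $c:V\to\{1,\dots,k\}$. $\mathcal G(n,p)$ is the binomial random graph on $n$ labelled vertices, each pair being an edge independently with probability $p$; a property holds *a.a.s.* if its probability tends to $1$ as $n\to\infty$. All asymptotics are as $n\to\infty$; $\lg$ is the logarithm to base $2$ and $\log$ the natural logarithm; $f\gg g$ means $g=o(f)$, and $f\sim g$ means $f=(1+o(1))g$. For $p\in(0,1)$ let $$s(p)=\min_{\ell\in\mathbb N}\Big\{[(1-p)^\ell]^2+[1-(1-p)^\ell]^2\Big\},\qquad r(p)=\frac{2}{\lg(1/s(p))}.$$ **Theorem.** Let $\varepsilon\in(0,1)$ and let $p=p(n)\in[0,1]$ satisfy $$np\to\infty,\qquad p\gg\frac{(\log n)^2(\log(np))^2}{n}\qquad\text{and}\qquad p\le 1-\varepsilon \text{ for all large } n.$$ Let $G\in\mathcal G(n,p)$. Then the following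 holds a.a.s. (i) If $p$ is a constant, then $\chi_s(G)\sim r(p)\lg n$. (ii) If $p=o(1)$ and $np=n^{\alpha+o(1)}$ for some $\alpha\in(0,1]$, then $$(2\alpha+o(1))\lg n\le\chi_s(G)\le(1+\alpha+o(1))\lg n.$$ (iii) If $np=n^{o(1)}$, then $$2\big(\lg(np)-\lg\log n-\lg\log(np)\big)\le\chi_s(G)\le(1+o(1))\lg n.$$ Here each $o(1)$ in (i)–(iii) is a deterministic function of $n$ tending to $0$. -/

import Mathlib

open Filter Topology Asymptotics
open scoped unitInterval

namespace SimpleGraph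

/-- The neighbourhood colour set `C(v) = {c(u) : uv ∈ E}` of a vertex `v`. -/
def neighborColorSet {V κ : Type*} (G : SimpleGraph V) (c : V → κ) (v : V) : Set κ :=
  c '' G.neighborSet v

/-- A (not necessarily proper) colouring is a set colouring if adjacent vertices have distinct
neighbourhood colour sets. -/
def IsSetColoring {V κ : Type*} (G : SimpleGraph V) (c : V → κ) : Prop :=
  ∀ ⦃u v : V⦄, G.Adj u v → G.neighborColorSet c u ≠ G.neighborColorSet c v

/-- The set chromatic number `χ_s(G)` of a (finite) graph: the least `k` such that `G` has a set
colouring with colours in a set of size `k`. -/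
noncomputable def setChromaticNumber {V : Type*} (G : SimpleGraph V) : ℕ :=
  sInf {k : ℕ | ∃ c : V → Fin k, G.IsSetColoring c}

/-- Any graph on `n` vertices has a set colouring with `n` colours, so that for finite graphs the
infimum defining `χ_s` is a minimum. -/
theorem setChromaticNumber_mem {n : ℕ} (G : SimpleGraph (Fin n)) :
    ∃ c : Fin n → Fin G.setChromaticNumber, G.IsSetColoring c := by
  refine Nat.sInf_mem (s := {k : ℕ | ∃ c : Fin n → Fin k, G.IsSetColoring c}) ⟨n, id, ?_⟩
  intro u v huv h
  have hv : v ∈ G.neighborColorSet (id : Fin n → Fin n) u := ⟨v, huv, rfl⟩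
  rw [h] at hv
  obtain ⟨w, hw, rfl⟩ := hv
  exact G.loopless.irrefl _ hw

end SimpleGraph

/-- `[(1-p)^ℓ]² + [1-(1-p)^ℓ]²`: the probability that two fixed vertices outside a set of `ℓ`
vertices either both have, or both do not have, a neighbour in that set. -/
noncomputable def agreeProb (p : ℝ) (ℓ : ℕ) : ℝ :=
  ((1 - p) ^ ℓ) ^ 2 + (1 - (1 - p) ^ ℓ) ^ 2

/-- `s(p)`, the minimum over `ℓ ∈ ℕ` of `[(1-p)^ℓ]² + [1-(1-p)^ℓ]²`. -/
noncomputable def minAgreeProb (p : ℝ) : ℝ := ⨅ ℓ : ℕ, agreeProb p ℓ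

/-- The infimum in the definition of `s(p)` is attained, i.e. it is a minimum. -/
theorem minAgreeProb_isLeast {p : ℝ} (h0 : 0 < p) (h1 : p < 1) :
    IsLeast (Set.range (agreeProb p)) (minAgreeProb p) := by
  have hlim : Tendsto (agreeProb p) atTop (𝓝 1) := by
    have h := tendsto_pow_atTop_nhds_zero_of_lt_one (r := 1 - p) (by linarith) (by linarith)
    have h2 := (h.pow 2).add (((tendsto_const_nhds (x := (1 : ℝ))).sub h).pow 2)
    simpa [Function.comp_def] using (show Tendsto (agreeProb p) atTop _ from h2)
  have hlt : agreeProb p 1 < 1 := by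
    simp only [agreeProb, pow_one]; nlinarith
  obtain ⟨N, hN⟩ := eventually_atTop.1 (hlim.eventually (lt_mem_nhds hlt))
  obtain ⟨m, -, hm⟩ := Finset.exists_min_image (Finset.range (N + 2)) (agreeProb p) ⟨0, by simp⟩
  have hmin : ∀ ℓ, agreeProb p m ≤ agreeProb p ℓ := by
    intro ℓ
    rcases lt_or_ge ℓ (N + 2) with hl | hl
    · exact hm ℓ (Finset.mem_range.2 hl)
    · exact (hm 1 (by simp)).trans (hN ℓ (by omega)).le
  have hleast : IsLeast (Set.range (agreeProb p)) (agreeProb p m) :=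
    ⟨⟨m, rfl⟩, by rintro _ ⟨ℓ, rfl⟩; exact hmin ℓ⟩
  have : minAgreeProb p = agreeProb p m := hleast.csInf_eq
  rwa [this]

/-- The zigzag function `r(p) = 2 / lg (1 / s(p))`. -/
noncomputable def zigzag (p : ℝ) : ℝ := 2 / Real.logb 2 (1 / minAgreeProb p)

/-- The property `E` of the binomial random graph `G(n, p(n))` on `n` labelled vertices holds
asymptotically almost surely: its probability tends to `1` as `n → ∞`. -/
def HoldsAAS (p : ℕ → I) (E : (n : ℕ) → SimpleGraph (Fin n) → Prop) : Prop :=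
  Tendsto (fun n : ℕ => SimpleGraph.binomialRandom (Fin n) (p n) {G | E n G}) atTop (𝓝 1)

/-- `f(n) = n^{α + o(1)}`. -/
def IsPowOneLittleO (f : ℕ → ℝ) (α : ℝ) : Prop :=
  ∃ e : ℕ → ℝ, Tendsto e atTop (𝓝 0) ∧ ∀ᶠ n : ℕ in atTop, f n = (n : ℝ) ^ (α + e n)

/-!
The set chromatic number of `G(n, p)` is governed by collisions. Give each vertex `v` the set
`C(v)` of colours it sees. A colour class of size `ℓ` distinguishes two fixed vertices outside of
it unless they agree on having a neighbour in it, which happens with probability `agreeProb p ℓ`,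
and different classes act independently (`sum_seenProb_sq`).

*Upper bound.* Take `k` disjoint classes of a size `ℓ` that makes the agreement probability
smallest (about `1 / 2` if `p = o(1)`), and give all other vertices one more colour. The expected
number of adjacent pairs with equal colour sets is at most `n² p (agreeProb p ℓ) ^ (k - 2)`
(`binomialRandom_not_exists_isSetColoring_le`), which tends to `0` for `k` above the claimed
value.

*Lower bound.* Let `s ≈ 3 log n / p`. A.a.s. any two disjoint sets of `s` vertices are joined by an
edge, so a colour class with at least `s` vertices is seen by all but `2 s` vertices and is useless for
telling the others apart. Hence a set colouring with `k` colours provides a set of `r = 2 k s`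
vertices, partially coloured, such that the remaining vertices `w`, labelled by the set of colours
which they see among these `r` vertices, contain no adjacent pair with equal labels
(`exists_seenFrom_of_isSetColoring`). There are only `exp (O (r log n))` choices of the partially
coloured set. For a fixed choice, the labels of the `N ≥ n / 2` remaining vertices are independent
with a common distribution `x`, and independent of the edges among these vertices. So the
probability that no collision of labels is an edge is the expectation of `(1 - p) ^ Y`, where `Y`
is the number of pairs of equal labels. Comparing the occupation numbers of the labels with
independent Poisson variables of means `N x i` yields the bound
`e N exp (-c ∑ i, min (p (N x i)²) (N x i))` (`exists_collision_bound`).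

This exponent is estimated in two ways. There are at most `2 ^ k` labels, so it is at least of
order `min (p N² / 2 ^ k) N` (`min_le_sum_min_of_card`); this gives
`χ_s ≥ 2 (lg (np) - lg log n - lg log (np))` for all `p` bounded away from `1`, and with it the lower bounds for `p = o(1)`. For
constant `p` the exponent is at least of order `min (p N² β) (N √β)`, where
`β = ∑ i, (x i)² ≥ s(p) ^ k` (`min_le_sum_min_of_sum_sq`).
-/

open MeasureTheory ProbabilityTheory

/-! ### Edge patterns in the binomial random graph -/

namespace SimpleGraph

instance discreteMeasurableSpace_of_finite {V : Type*} [Finite V] :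
    DiscreteMeasurableSpace (SimpleGraph V) where
  forall_measurableSet S := by
    have h : ∀ G : SimpleGraph V, MeasurableSet ({G} : Set (SimpleGraph V)) := fun G => by
      have h1 : ({G} : Set (SimpleGraph V)) = edgeSet ⁻¹' {G.edgeSet} := by
        ext H; simp
      rw [h1]
      exact measurable_edgeSet (Set.Finite.measurableSet (Set.finite_singleton _))
    rw [← Set.biUnion_of_singleton S]
    exact S.toFinite.measurableSet_biUnion fun G _ => h G

end SimpleGraph

/-- The mass of a Bernoulli variable of parameter `p` at the Boolean `b`. -/
noncomputable def bernoulliWeight (p : ℝ) (b : Bool) : ℝ := if b then p else 1 - p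

lemma sum_bernoulliWeight (p : ℝ) : ∑ b, bernoulliWeight p b = 1 := by
  simp [bernoulliWeight]

lemma bernoulliWeight_nonneg (p : I) (b : Bool) : 0 ≤ bernoulliWeight p b := by
  unfold bernoulliWeight
  split_ifs
  · exact p.2.1
  · linarith [p.2.2]

namespace SimpleGraph

/-- Finitely many distinct edges are present independently of each other. -/
lemma binomialRandom_edge_pattern {V J : Type*} [Finite V] [Fintype J] (p : I) (e : J → Sym2 V)
    (he : Function.Injective e) (hd : ∀ j, ¬ (e j).IsDiag) (t : J → Bool) :
    (binomialRandom V p).real {G | ∀ j, e j ∈ G.edgeSet ↔ t j = true} =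
      ∏ j, bernoulliWeight p (t j) := by
  classical
  have hm : MeasurableSet {G : SimpleGraph V | ∀ j, e j ∈ G.edgeSet ↔ t j = true} :=
    MeasurableSet.of_discrete
  have hm2 : MeasurableSet (fromEdgeSet ⁻¹'
    {G : SimpleGraph V | ∀ j, e j ∈ G.edgeSet ↔ t j = true}) := measurable_fromEdgeSet hm
  set τ : Sym2 V → Prop := fun z => ∃ j, e j = z ∧ t j = true with hτ
  have hset : (fun f : Sym2 V → Prop => {z | f z}) ⁻¹' (fromEdgeSet ⁻¹'
      {G : SimpleGraph V | ∀ j, e j ∈ G.edgeSet ↔ t j = true}) =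
      ((Finset.univ.image e : Finset (Sym2 V)) : Set (Sym2 V)).pi (fun z => {τ z}) := by
    ext f
    simp only [Set.mem_preimage, edgeSet_fromEdgeSet, Set.mem_ofPred_eq, Set.mem_sdiff,
      Finset.coe_image, Finset.coe_univ, Set.image_univ, Set.mem_pi, Set.mem_range,
      Set.mem_singleton_iff, forall_exists_index, forall_apply_eq_imp_iff]
    refine forall_congr' fun j => ?_
    have h1 : τ (e j) ↔ t j = true := by
      simp only [hτ]
      constructor
      · rintro ⟨i, hi, h⟩
        rwa [← he hi]
      · exact fun h => ⟨j, rfl, h⟩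
    rw [eq_iff_iff, h1]
    have := hd j
    simp [this]
  rw [measureReal_def, binomialRandom_eq_map, Measure.map_apply measurable_fromEdgeSet hm,
    setBernoulli_eq_map]
  rw [Measure.map_apply (by fun_prop) hm2, hset, Measure.infinitePi_pi _ (by simp),
    Finset.prod_image he.injOn, ENNReal.toReal_prod]
  refine Finset.prod_congr rfl fun j _ => ?_
  have h1 : τ (e j) ↔ t j = true := by
    simp only [hτ]
    constructor
    · rintro ⟨i, hi, h⟩
      rwa [← he hi]
    · exact fun h => ⟨j, rfl, h⟩
  have := hd j
  rcases hb : t j with _ | _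
  · simp [bernoulliWeight, h1, hb, this]
  · simp [bernoulliWeight, h1, hb, this]

end SimpleGraph

/-! ### Seen colours and their independence -/

section SeenColors

variable {Γ κ : Type*} [Fintype Γ] [Fintype κ] [DecidableEq κ]

/-- The colours `i` that a vertex sees among coloured vertices indexed by `Γ`, when `b` records to
which of these it is adjacent. The colouring `τ` is partial: an index `j` with `τ j = none` carries
no colour. -/
def seenColors (τ : Γ → Option κ) (b : Γ → Bool) : Finset κ :=
  Finset.univ.filter fun i => ∃ j, τ j = some i ∧ b j = true

/-- The probability that a vertex sees exactly the colours `S`, when it is adjacent to each of the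
coloured vertices independently with probability `p`. -/
noncomputable def seenProb (p : ℝ) (τ : Γ → Option κ) (S : Finset κ) : ℝ := by
  classical
  exact ∑ b : Γ → Bool, if seenColors τ b = S then ∏ j, bernoulliWeight p (b j) else 0

lemma seenProb_nonneg (p : I) (τ : Γ → Option κ) (S : Finset κ) : 0 ≤ seenProb p τ S := by
  classical
  unfold seenProb
  refine Finset.sum_nonneg fun b _ => ?_
  split_ifs
  · exact Finset.prod_nonneg fun j _ => bernoulliWeight_nonneg p _
  · exact le_rfl

open scoped Classical in
lemma sum_prod_bernoulliWeight (p : ℝ) : ∑ b : Γ → Bool, ∏ j, bernoulliWeight p (b j) = 1 := by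
  classical
  rw [← Fintype.piFinset_univ, ← Finset.prod_univ_sum (fun _ => Finset.univ)
    (fun (_ : Γ) b => bernoulliWeight p b)]
  simp [bernoulliWeight]

lemma sum_seenProb (p : ℝ) (τ : Γ → Option κ) : ∑ S, seenProb p τ S = 1 := by
  classical
  unfold seenProb
  rw [Finset.sum_comm]
  simpa using sum_prod_bernoulliWeight p

open scoped Classical in
/-- The probability that no colour in `Z` is seen. -/
lemma sum_weight_avoid (p : ℝ) (τ : Γ → Option κ) (Z : Finset κ) :
    ∑ b : Γ → Bool, (∏ i ∈ Z, if i ∈ seenColors τ b then (0 : ℝ) else 1) *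
        ∏ j, bernoulliWeight p (b j) =
      ∏ i ∈ Z, (1 - p) ^ (Fintype.card {j // τ j = some i}) := by
  classical
  have h1 : ∀ b : Γ → Bool, (∏ i ∈ Z, if i ∈ seenColors τ b then (0 : ℝ) else 1) =
      ∏ j, if (∃ i ∈ Z, τ j = some i) ∧ b j = true then (0 : ℝ) else 1 := by
    intro b
    by_cases h : ∃ i ∈ Z, i ∈ seenColors τ b
    · obtain ⟨i, hi, hs⟩ := h
      rw [Finset.prod_eq_zero hi (by simp [hs])]
      simp only [seenColors, Finset.mem_filter, Finset.mem_univ, true_and] at hs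
      obtain ⟨j, hj, hb⟩ := hs
      rw [Finset.prod_eq_zero (Finset.mem_univ j)]
      rw [if_pos ⟨⟨i, hi, hj⟩, hb⟩]
    · push Not at h
      rw [Finset.prod_eq_one fun i hi => by simp [h i hi], Finset.prod_eq_one]
      intro j _
      rw [if_neg]
      rintro ⟨⟨i, hi, hj⟩, hb⟩
      refine h i hi ?_
      simp only [seenColors, Finset.mem_filter, Finset.mem_univ, true_and]
      exact ⟨j, hj, hb⟩
  simp_rw [h1, ← Finset.prod_mul_distrib]
  rw [← Fintype.piFinset_univ, ← Finset.prod_univ_sum (fun _ => Finset.univ)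
    (fun (j : Γ) b => (if (∃ i ∈ Z, τ j = some i) ∧ b = true then (0 : ℝ) else 1) *
      bernoulliWeight p b)]
  have h2 : ∀ j : Γ, ∑ b : Bool, (if (∃ i ∈ Z, τ j = some i) ∧ b = true then (0 : ℝ) else 1) *
      bernoulliWeight p b = ∏ i ∈ Z, if τ j = some i then (1 - p) else 1 := by
    intro j
    by_cases h : ∃ i ∈ Z, τ j = some i
    · obtain ⟨i, hi, hj⟩ := h
      rw [Finset.prod_eq_single i]
      · simp [bernoulliWeight, hj, hi]
      · intro i' _ hne
        rw [if_neg]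
        rw [hj]
        simpa using hne.symm
      · exact fun h => absurd hi h
    · have h' := h
      push Not at h'
      rw [Finset.prod_eq_one fun i hi => by simp [h' i hi]]
      simp only [h, false_and, if_false, one_mul]
      exact sum_bernoulliWeight p
  rw [Finset.prod_congr rfl fun j _ => h2 j, Finset.prod_comm]
  refine Finset.prod_congr rfl fun i _ => ?_
  rw [Finset.prod_ite, Finset.prod_const, Finset.prod_const_one, mul_one, Fintype.card_subtype]

/-- Colours are seen independently of each other. -/
lemma seenProb_eq_prod (p : ℝ) (τ : Γ → Option κ) (S : Finset κ) :
    seenProb p τ S = (∏ i ∈ S, (1 - (1 - p) ^ (Fintype.card {j // τ j = some i}))) *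
      ∏ i ∈ Finset.univ \ S, (1 - p) ^ (Fintype.card {j // τ j = some i}) := by
  classical
  set a : κ → ℝ := fun i => (1 - p) ^ (Fintype.card {j // τ j = some i}) with ha
  set y : (Γ → Bool) → κ → ℝ := fun b i => if i ∈ seenColors τ b then (0 : ℝ) else 1 with hy
  have h1 : ∀ b : Γ → Bool, (if seenColors τ b = S then ∏ j, bernoulliWeight p (b j) else 0) =
      ((∏ i ∈ S, (1 - y b i)) * ∏ i ∈ Finset.univ \ S, y b i) *
        ∏ j, bernoulliWeight p (b j) := by
    intro b
    split_ifs with h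
    · have hS : ∏ i ∈ S, (1 - y b i) = 1 := Finset.prod_eq_one fun i hi => by
        rw [← h] at hi
        simp only [hy]
        rw [if_pos hi, sub_zero]
      have hSc : ∏ i ∈ Finset.univ \ S, y b i = 1 := Finset.prod_eq_one fun i hi => by
        rw [← h] at hi
        simp only [hy]
        rw [if_neg (Finset.mem_sdiff.1 hi).2]
      rw [hS, hSc, one_mul, one_mul]
    · have : ∃ i, ¬ (i ∈ seenColors τ b ↔ i ∈ S) := by
        by_contra hc
        push Not at hc
        exact h (Finset.ext hc)
      obtain ⟨i, hi⟩ := this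
      by_cases hiS : i ∈ S
      · rw [Finset.prod_eq_zero hiS, zero_mul, zero_mul]
        have : i ∉ seenColors τ b := fun hh => hi ⟨fun _ => hiS, fun _ => hh⟩
        simp [hy, this]
      · rw [Finset.prod_eq_zero (i := i) (s := Finset.univ \ S) (by simp [hiS]), mul_zero, zero_mul]
        have : i ∈ seenColors τ b := by
          by_contra hh
          exact hi ⟨fun h => absurd h hh, fun h => absurd h hiS⟩
        simp [hy, this]
  -- Both sides are affine in each factor, so that the mixed moments of `y` determine the sum.
  have h2 : ∀ g : κ → ℝ, (∏ i ∈ S, (1 - g i)) * ∏ i ∈ Finset.univ \ S, g i =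
      ∑ T ∈ S.powerset, (-1) ^ T.card * ∏ i ∈ T ∪ (Finset.univ \ S), g i := by
    intro g
    have : ∏ i ∈ S, (1 - g i) = ∑ T ∈ S.powerset, (-1) ^ T.card * ∏ i ∈ T, g i := by
      rw [Finset.prod_congr rfl fun i _ => (by ring : 1 - g i = -g i + 1), Finset.prod_add]
      refine Finset.sum_congr rfl fun T _ => ?_
      rw [Finset.prod_const_one, mul_one, Finset.prod_neg]
    rw [this, Finset.sum_mul]
    refine Finset.sum_congr rfl fun T hT => ?_
    rw [Finset.prod_union, mul_assoc]
    rw [Finset.mem_powerset] at hT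
    exact Finset.disjoint_left.2 fun i hi hi' => (Finset.mem_sdiff.1 hi').2 (hT hi)
  unfold seenProb
  rw [Finset.sum_congr rfl fun b _ => h1 b, h2 a]
  simp_rw [h2, Finset.sum_mul]
  rw [Finset.sum_comm]
  refine Finset.sum_congr rfl fun T _ => ?_
  rw [← sum_weight_avoid, Finset.mul_sum]
  refine Finset.sum_congr rfl fun b _ => ?_
  ring

/-- The probability that two vertices see the same colours is the product of the probabilities
that they agree on each colour. -/
lemma sum_seenProb_sq (p : ℝ) (τ : Γ → Option κ) :
    ∑ S, seenProb p τ S ^ 2 = ∏ i, agreeProb p (Fintype.card {j // τ j = some i}) := by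
  classical
  have h : ∀ i, agreeProb p (Fintype.card {j // τ j = some i}) =
      (1 - (1 - p) ^ (Fintype.card {j // τ j = some i})) ^ 2 +
        ((1 - p) ^ (Fintype.card {j // τ j = some i})) ^ 2 := fun i => by
    unfold agreeProb; ring
  simp_rw [h]
  rw [Finset.prod_add, Finset.powerset_univ]
  refine Finset.sum_congr rfl fun S _ => ?_
  rw [seenProb_eq_prod, mul_pow, Finset.prod_pow, Finset.prod_pow]

end SeenColors

namespace SimpleGraph

section Pattern

open scoped Classical in
/-- The colours that the vertex `v` of `G` sees among the vertices `ρ j` coloured by `τ`. -/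
noncomputable def seenFrom {V Γ κ : Type*} [Fintype κ] [DecidableEq κ] [Fintype Γ] (ρ : Γ → V)
    (τ : Γ → Option κ) (G : SimpleGraph V) (v : V) : Finset κ :=
  seenColors τ fun j => decide (G.Adj v (ρ j))

variable {V Γ κ Ω J : Type*} [Finite V] [Fintype Γ] [Fintype κ] [DecidableEq κ] [Fintype Ω]
  [Fintype J]

/-- The sets of colours seen by vertices outside of the coloured ones are independent, and
independent of the edges `e z` that avoid the coloured vertices. -/
lemma binomialRandom_seenFrom (p : I) {ρ : Γ → V} (hρ : Function.Injective ρ) (τ : Γ → Option κ)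
    {ω : Ω → V} (hω : Function.Injective ω) (hωρ : ∀ w j, ω w ≠ ρ j) {e : J → Sym2 V}
    (he : Function.Injective e) (hd : ∀ z, ¬ (e z).IsDiag) (heρ : ∀ z j, ρ j ∉ e z)
    (χ : Ω → Finset κ) (t : J → Bool) :
    (binomialRandom V p).real {G | (∀ w, seenFrom ρ τ G (ω w) = χ w) ∧
        ∀ z, e z ∈ G.edgeSet ↔ t z = true} =
      (∏ w, seenProb p τ (χ w)) * ∏ z, bernoulliWeight p (t z) := by
  classical
  set A : (Ω → Γ → Bool) → Set (SimpleGraph V) := fun b =>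
    {G | (∀ w j, G.Adj (ω w) (ρ j) ↔ b w j = true) ∧ ∀ z, e z ∈ G.edgeSet ↔ t z = true} with hA
  have hAp : ∀ b, (binomialRandom V p).real (A b) =
      (∏ w, ∏ j, bernoulliWeight p (b w j)) * ∏ z, bernoulliWeight p (t z) := by
    intro b
    set e' : (Ω × Γ) ⊕ J → Sym2 V := Sum.elim (fun wj => s(ω wj.1, ρ wj.2)) e with he'
    have hinj : Function.Injective e' := by
      refine Function.Injective.sumElim ?_ he ?_
      · rintro ⟨w, j⟩ ⟨w', j'⟩ h
        rcases Sym2.eq_iff.1 h with ⟨h1, h2⟩ | ⟨h1, h2⟩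
        · exact Prod.ext (hω h1) (hρ h2)
        · exact absurd h1 (hωρ _ _)
      · rintro ⟨w, j⟩ z h
        refine heρ z j ?_
        rw [← h]
        exact Sym2.mem_mk_right _ _
    have hdiag : ∀ x, ¬ (e' x).IsDiag := by
      rintro (⟨w, j⟩ | z)
      · simpa [he'] using hωρ w j
      · simpa [he'] using hd z
    have := binomialRandom_edge_pattern p e' hinj hdiag
      (Sum.elim (fun wj => b wj.1 wj.2) t)
    rw [Fintype.prod_sum_type, Fintype.prod_prod_type] at this
    simp only [Sum.elim_inl, Sum.elim_inr] at this
    rw [← this]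
    congr 1
    ext G
    simp [hA, he', Sum.forall]
  have hset : {G : SimpleGraph V | (∀ w, seenFrom ρ τ G (ω w) = χ w) ∧
        ∀ z, e z ∈ G.edgeSet ↔ t z = true} =
      ⋃ b : Ω → Γ → Bool, if ∀ w, seenColors τ (b w) = χ w then A b else ∅ := by
    ext G
    simp only [Set.mem_ofPred_eq, Set.mem_iUnion]
    constructor
    · rintro ⟨h1, h2⟩
      refine ⟨fun w j => decide (G.Adj (ω w) (ρ j)), ?_⟩
      have h3 : ∀ w, seenColors τ ((fun w j => decide (G.Adj (ω w) (ρ j))) w) = χ w :=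
        fun w => h1 w
      rw [if_pos h3]
      exact ⟨fun w j => by simp, h2⟩
    · rintro ⟨b, hb⟩
      split_ifs at hb with h
      · refine ⟨fun w => ?_, hb.2⟩
        rw [← h w]
        unfold seenFrom
        congr 1
        ext j
        have := hb.1 w j
        by_cases hh : G.Adj (ω w) (ρ j)
        · simp [hh, this.1 hh]
        · have h3 : ¬ (b w j = true) := fun h => hh (this.2 h)
          simp [hh, h3]
      · exact absurd hb (Set.notMem_empty _)
  rw [hset, measureReal_iUnion_fintype]
  · have h1 : ∀ b : Ω → Γ → Bool, (binomialRandom V p).real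
        (if ∀ w, seenColors τ (b w) = χ w then A b else ∅) =
        (∏ w, (if seenColors τ (b w) = χ w then ∏ j, bernoulliWeight p (b w j) else 0)) *
          ∏ z, bernoulliWeight p (t z) := by
      intro b
      split_ifs with h
      · rw [hAp]
        congr 1
        exact Finset.prod_congr rfl fun w _ => by rw [if_pos (h w)]
      · push Not at h
        obtain ⟨w, hw⟩ := h
        rw [Finset.prod_eq_zero (Finset.mem_univ w) (by rw [if_neg hw])]
        simp
    rw [Finset.sum_congr rfl fun b _ => h1 b, ← Finset.sum_mul]
    congr 1
    rw [← Fintype.piFinset_univ, ← Finset.prod_univ_sum (fun _ => Finset.univ)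
      (fun (w : Ω) b => (if seenColors τ b = χ w then ∏ j, bernoulliWeight p (b j) else 0))]
    refine Finset.prod_congr rfl fun w _ => ?_
    unfold seenProb
    congr!
  · intro b b' hne
    rw [Function.onFun, Set.disjoint_left]
    intro G hG hG'
    split_ifs at hG hG' with h h'
    · apply hne
      ext w j
      have h1 := hG.1 w j
      have h2 := hG'.1 w j
      rw [Bool.eq_iff_iff, ← h1, ← h2]
    all_goals simp at hG hG'
  · exact fun b => MeasurableSet.of_discrete

/-- The pairs of distinct elements to which `χ` gives the same value. -/
def agreeingPairs {α β : Type*} (χ : α → β) : Set (Sym2 α) :=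
  {z | ¬ z.IsDiag ∧ (z.map χ).IsDiag}

open scoped Classical in
/-- Conditioning on the sets `χ w` of seen colours, the edges among the vertices `ω w` are still
independent, and exactly the pairs on which `χ` agrees have to be non-edges. -/
lemma binomialRandom_adj_imp_seenFrom_ne (p : I) {ρ : Γ → V} (hρ : Function.Injective ρ)
    (τ : Γ → Option κ) {ω : Ω → V} (hω : Function.Injective ω) (hωρ : ∀ w j, ω w ≠ ρ j) :
    (binomialRandom V p).real {G | ∀ u v, G.Adj (ω u) (ω v) →
        seenFrom ρ τ G (ω u) ≠ seenFrom ρ τ G (ω v)} =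
      ∑ χ : Ω → Finset κ, (∏ w, seenProb p τ (χ w)) *
        (1 - (p : ℝ)) ^ (agreeingPairs χ).ncard := by
  classical
  have hset : {G : SimpleGraph V | ∀ u v, G.Adj (ω u) (ω v) →
        seenFrom ρ τ G (ω u) ≠ seenFrom ρ τ G (ω v)} =
      ⋃ χ : Ω → Finset κ, {G | (∀ w, seenFrom ρ τ G (ω w) = χ w) ∧
        ∀ z : agreeingPairs χ, (z : Sym2 Ω).map ω ∈ G.edgeSet ↔ false = true} := by
    ext G
    simp only [Set.mem_ofPred_eq, Set.mem_iUnion, Bool.false_eq_true, iff_false]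
    constructor
    · intro h
      refine ⟨fun w => seenFrom ρ τ G (ω w), fun _ => rfl, ?_⟩
      rintro ⟨z, hz⟩
      induction z using Sym2.ind with
      | _ u v =>
        intro hadj
        exact h u v (by simpa using hadj) (by simpa using hz.2)
    · rintro ⟨χ, h1, h2⟩ u v hadj heq
      rw [h1, h1] at heq
      refine h2 ⟨s(u, v), ?_, ?_⟩ (by simpa using hadj)
      · intro hd
        have : u = v := by simpa using hd
        rw [this] at hadj
        exact G.loopless.irrefl _ hadj
      · simpa using heq
  rw [hset, measureReal_iUnion_fintype]
  · refine Finset.sum_congr rfl fun χ _ => ?_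
    rw [binomialRandom_seenFrom p hρ τ hω hωρ
      (e := fun z : agreeingPairs χ => (z : Sym2 Ω).map ω) _ _ _ χ (fun _ => false)]
    · simp [bernoulliWeight, ← Nat.card_eq_fintype_card, Nat.card_coe_set_eq]
    · exact (Sym2.map.injective hω).comp Subtype.val_injective
    · rintro ⟨z, hz⟩
      induction z using Sym2.ind with
      | _ u v =>
        intro h
        apply hz.1
        simpa [hω.eq_iff] using h
    · rintro ⟨z, hz⟩ j h
      obtain ⟨w, _, hw⟩ := Sym2.mem_map.1 h
      exact hωρ w j hw
  · intro χ χ' hne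
    rw [Function.onFun, Set.disjoint_left]
    rintro G ⟨h, _⟩ ⟨h', _⟩
    exact hne (funext fun w => (h w).symm.trans (h' w))
  · exact fun b => MeasurableSet.of_discrete

/-- The probability that two fixed vertices outside of the coloured ones are adjacent and see the
same colours. -/
lemma binomialRandom_adj_and_seenFrom_eq (p : I) {ρ : Γ → V} (hρ : Function.Injective ρ)
    (τ : Γ → Option κ) {u v : V} (huv : u ≠ v) (hu : ∀ j, u ≠ ρ j) (hv : ∀ j, v ≠ ρ j) :
    (binomialRandom V p).real {G | G.Adj u v ∧ seenFrom ρ τ G u = seenFrom ρ τ G v} =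
      p * ∏ i, agreeProb p (Fintype.card {j // τ j = some i}) := by
  classical
  have hset : {G : SimpleGraph V | G.Adj u v ∧ seenFrom ρ τ G u = seenFrom ρ τ G v} =
      ⋃ S : Finset κ, {G | (∀ w : Bool, seenFrom ρ τ G (if w then u else v) = S) ∧
        ∀ _z : Unit, s(u, v) ∈ G.edgeSet ↔ true = true} := by
    ext G
    simp only [Set.mem_ofPred_eq, Set.mem_iUnion, Bool.forall_bool]
    constructor
    · rintro ⟨h, h2⟩
      exact ⟨seenFrom ρ τ G u, ⟨by simp [h2], by simp⟩, by simpa using h⟩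
    · rintro ⟨S, ⟨h1, h2⟩, h3⟩
      refine ⟨by simpa using h3, ?_⟩
      simp only [if_true, Bool.false_eq_true, if_false] at h1 h2
      rw [h1, h2]
  rw [hset, measureReal_iUnion_fintype]
  · rw [← sum_seenProb_sq, Finset.mul_sum]
    refine Finset.sum_congr rfl fun S _ => ?_
    have := binomialRandom_seenFrom p hρ τ (ω := fun w : Bool => if w then u else v)
      (e := fun _ : Unit => s(u, v)) ?_ ?_ ?_ ?_ ?_ (fun _ => S) (fun _ => true)
    · rw [this]
      simp [bernoulliWeight]
      ring
    · rintro (_ | _) (_ | _) h <;> simp_all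
    · rintro (_ | _) j <;> simp [hu, hv]
    · exact fun _ _ _ => rfl
    · simpa using huv
    · intro _ j h
      rcases Sym2.mem_iff.1 h with h | h
      · exact hu j h.symm
      · exact hv j h.symm
  · intro χ χ' hne
    rw [Function.onFun, Set.disjoint_left]
    rintro G ⟨h, _⟩ ⟨h', _⟩
    exact hne ((h true).symm.trans (h' true))
  · exact fun b => MeasurableSet.of_discrete

end Pattern

end SimpleGraph

/-! ### Collisions of independent labels -/

section Poissonization

variable {Ω ι : Type*} [Fintype Ω] [Fintype ι]

open scoped Classical in
/-- Functions `χ` are counted by their occupation numbers through multinomial coefficients. -/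
lemma sum_functions_eq_sum_multinomial (F : (ι → ℕ) → ℝ) :
    ∑ χ : Ω → ι, F (fun i => (Finset.univ.filter fun w => χ w = i).card) =
      ∑ k ∈ Finset.univ.piAntidiag (Fintype.card Ω), (Nat.multinomial Finset.univ k : ℝ) * F k := by
  -- Expand `(∑ X i) ^ card Ω` in two ways and apply the linear map with `X ^ k ↦ F k`.
  set L : MvPolynomial ι ℝ →ₗ[ℝ] ℝ := (MvPolynomial.basisMonomials ι ℝ).constr ℝ
    (fun m => F m) with hL
  have hLm : ∀ (k : ι → ℕ), L (∏ i, (MvPolynomial.X i : MvPolynomial ι ℝ) ^ k i) = F k := by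
    intro k
    have h1 : ∏ i, (MvPolynomial.X i : MvPolynomial ι ℝ) ^ k i =
        MvPolynomial.basisMonomials ι ℝ (Finsupp.equivFunOnFinite.symm k) := by
      rw [MvPolynomial.coe_basisMonomials]
      beta_reduce
      rw [MvPolynomial.monomial_eq, Finsupp.prod_fintype]
      · simp
      · simp
    rw [h1, hL, Module.Basis.constr_basis]
    rfl
  have e1 : (∑ i, (MvPolynomial.X i : MvPolynomial ι ℝ)) ^ Fintype.card Ω =
      ∑ χ : Ω → ι, ∏ i, (MvPolynomial.X i : MvPolynomial ι ℝ) ^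
        (Finset.univ.filter fun w => χ w = i).card := by
    rw [← Finset.card_univ, ← Finset.prod_const, Finset.prod_univ_sum, Fintype.piFinset_univ]
    refine Finset.sum_congr rfl fun χ _ => ?_
    rw [← Finset.prod_fiberwise (s := Finset.univ) (g := χ)]
    refine Finset.prod_congr rfl fun i _ => ?_
    rw [Finset.prod_congr rfl (g := fun _ => MvPolynomial.X i), Finset.prod_const]
    intro w hw
    rw [(Finset.mem_filter.1 hw).2]
  have e2 := congrArg L (e1.symm.trans
    (Finset.sum_pow_eq_sum_piAntidiag Finset.univ (fun i => (MvPolynomial.X i : MvPolynomial ι ℝ))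
      (Fintype.card Ω)))
  rw [map_sum, map_sum] at e2
  simp_rw [hLm] at e2
  rw [e2]
  refine Finset.sum_congr rfl fun k _ => ?_
  rw [← nsmul_eq_mul, map_nsmul, hLm, nsmul_eq_mul]

open scoped Classical in
/-- Comparison of a multinomial sample with a Poisson sample: the expectation of a product over the
cells `i` of functions of the occupation numbers exceeds its Poisson counterpart at most by the
factor `N! (e / N) ^ N`, the inverse of the probability that a Poisson variable of mean `N`
equals `N`. -/
lemma sum_prod_occupation_le (x : ι → ℝ) (hx : ∀ i, 0 ≤ x i) (f : ι → ℕ → ℝ)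
    (hf : ∀ i m, 0 ≤ f i m) :
    (Fintype.card Ω : ℝ) ^ Fintype.card Ω * ∑ χ : Ω → ι, (∏ w, x (χ w)) *
        ∏ i, f i (Finset.univ.filter fun w => χ w = i).card ≤
      (Fintype.card Ω).factorial * ∏ i, ∑ m ∈ Finset.range (Fintype.card Ω + 1),
        (Fintype.card Ω * x i) ^ m / m.factorial * f i m := by
  set N := Fintype.card Ω with hN
  have h1 : ∀ χ : Ω → ι, ∏ w, x (χ w) =
      ∏ i, x i ^ (Finset.univ.filter fun w => χ w = i).card := by
    intro χ
    rw [← Finset.prod_fiberwise (s := Finset.univ) (g := χ)]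
    refine Finset.prod_congr rfl fun i _ => ?_
    rw [Finset.prod_congr rfl (g := fun _ => x i), Finset.prod_const]
    intro w hw
    rw [(Finset.mem_filter.1 hw).2]
  simp_rw [h1, ← Finset.prod_mul_distrib]
  rw [sum_functions_eq_sum_multinomial (fun k => ∏ i, x i ^ k i * f i (k i)), ← hN,
    Finset.prod_univ_sum, Finset.mul_sum, Finset.mul_sum]
  have h2 : ∀ k ∈ (Finset.univ : Finset ι).piAntidiag N, (N : ℝ) ^ N *
      ((Nat.multinomial Finset.univ k : ℝ) * ∏ i, x i ^ k i * f i (k i)) =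
      N.factorial * ∏ i, (N * x i) ^ k i / (k i).factorial * f i (k i) := by
    intro k hk
    have hs : ∑ i, k i = N := (Finset.mem_piAntidiag.1 hk).1
    have hm : (∏ i, ((k i).factorial : ℝ)) * Nat.multinomial Finset.univ k = N.factorial := by
      have := Nat.multinomial_spec Finset.univ k
      rw [hs] at this
      exact_mod_cast this
    have hpos : (∏ i, ((k i).factorial : ℝ)) ≠ 0 :=
      Finset.prod_ne_zero_iff.2 fun i _ => by exact_mod_cast (k i).factorial_ne_zero
    have hNN : (N : ℝ) ^ N = ∏ i, (N : ℝ) ^ k i := by rw [Finset.prod_pow_eq_pow_sum, hs]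
    simp_rw [mul_pow, div_eq_mul_inv]
    rw [← hm, hNN]
    simp_rw [Finset.prod_mul_distrib, Finset.prod_inv_distrib]
    field_simp
  rw [Finset.sum_congr rfl h2]
  refine Finset.sum_le_sum_of_subset_of_nonneg ?_ ?_
  · intro k hk
    have hs : ∑ i, k i = N := (Finset.mem_piAntidiag.1 hk).1
    rw [Fintype.mem_piFinset]
    intro i
    rw [Finset.mem_range, Nat.lt_succ_iff, ← hs]
    exact Finset.single_le_sum (f := k) (fun _ _ => Nat.zero_le _) (Finset.mem_univ i)
  · intro k _ _
    refine mul_nonneg (by positivity) (Finset.prod_nonneg fun i _ => ?_)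
    exact mul_nonneg (div_nonneg (pow_nonneg (mul_nonneg (by positivity) (hx i)) _)
      (by positivity)) (hf _ _)

/-- A weak form of Stirling's upper bound. -/
lemma factorial_mul_exp_le {N : ℕ} (hN : 1 ≤ N) :
    (N.factorial : ℝ) * Real.exp N ≤ Real.exp 1 * N * (N : ℝ) ^ N := by
  induction N, hN using Nat.le_induction with
  | base => simp
  | succ N hN ih =>
    have hN0 : (0 : ℝ) < N := by exact_mod_cast hN
    have h1 : Real.exp 1 ≤ ((N + 1 : ℝ) / N) ^ (N + 1) := by
      have := Real.one_sub_inv_le_log_of_pos (x := (N + 1 : ℝ) / N) (by positivity)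
      have h2 : (1 : ℝ) ≤ (N + 1 : ℕ) * Real.log ((N + 1 : ℝ) / N) := by
        have h3 : (1 : ℝ) - ((N + 1 : ℝ) / N)⁻¹ = 1 / (N + 1) := by field_simp; ring
        rw [h3] at this
        calc (1 : ℝ) = (N + 1 : ℕ) * (1 / (N + 1)) := by push_cast; field_simp
          _ ≤ _ := by gcongr
      calc Real.exp 1 ≤ Real.exp ((N + 1 : ℕ) * Real.log ((N + 1 : ℝ) / N)) :=
            Real.exp_le_exp.2 h2
        _ = _ := by rw [Real.exp_nat_mul, Real.exp_log (by positivity)]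
    rw [Nat.factorial_succ]
    push_cast
    rw [Real.exp_add]
    calc ((N : ℝ) + 1) * N.factorial * (Real.exp N * Real.exp 1)
        = (N + 1) * Real.exp 1 * (N.factorial * Real.exp N) := by ring
      _ ≤ (N + 1) * ((N + 1 : ℝ) / N) ^ (N + 1) * (Real.exp 1 * N * (N : ℝ) ^ N) := by
          gcongr
      _ = Real.exp 1 * (N + 1) * (N + 1) ^ (N + 1) := by
          rw [div_pow]; field_simp; ring

end Poissonization

section Collisions

/-- A Poisson variable `m` of mean `y` satisfies `𝔼 (1 - p) ^ (m choose 2) ≤ exp (-c min (p y²) y)`.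
The sum is truncated and multiplied by `exp y`. -/
lemma exists_poisson_collision_bound {ε : ℝ} (hε0 : 0 < ε) :
    ∃ c : ℝ, 0 < c ∧ ∀ (p y : ℝ) (N : ℕ), 0 < p → p ≤ 1 - ε → 0 ≤ y →
      ∑ m ∈ Finset.range (N + 1), y ^ m / m.factorial * (1 - p) ^ (m.choose 2) ≤
        Real.exp (y - c * min (p * y ^ 2) y) := by
  -- The first entry serves `y ≤ 4 / ε`, the other two serve `4 / ε ≤ y`.
  refine ⟨min (Real.exp (-(4 / ε)) / 2) (min (ε / 32) (1 / 8)), by positivity, ?_⟩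
  intro p y N hp hpε hy
  set c := min (Real.exp (-(4 / ε)) / 2) (min (ε / 32) (1 / 8)) with hc
  have hc1 : c ≤ Real.exp (-(4 / ε)) / 2 := min_le_left _ _
  have hc2 : c ≤ ε / 32 := (min_le_right _ _).trans (min_le_left _ _)
  have hc3 : c ≤ 1 / 8 := (min_le_right _ _).trans (min_le_right _ _)
  have hc0 : 0 < c := by positivity
  have hq0 : 0 < 1 - p := by linarith
  have hq1 : 1 - p ≤ 1 := by linarith
  have hmin0 : 0 ≤ min (p * y ^ 2) y := by positivity
  rcases le_total y (4 / ε) with hyY | hyY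
  · -- For bounded `y`, already the event `2 ≤ m` suffices.
    have h1 : ∀ m ∈ Finset.range (N + 1), y ^ m / m.factorial * (1 - p) ^ (m.choose 2) ≤
        (1 - p) * (y ^ m / m.factorial) +
          p * (if m < 2 then y ^ m / m.factorial else 0) := by
      intro m _
      have h0 : 0 ≤ y ^ m / m.factorial := by positivity
      split_ifs with hm
      · rw [Nat.choose_eq_zero_of_lt hm]; nlinarith
      · have : (1 - p) ^ (m.choose 2) ≤ (1 - p) ^ 1 :=
          pow_le_pow_of_le_one hq0.le hq1 (Nat.choose_pos (by omega))
        nlinarith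
    have h2 : ∑ m ∈ Finset.range (N + 1), (if m < 2 then y ^ m / m.factorial else 0) ≤ 1 + y := by
      rw [← Finset.sum_filter]
      calc _ ≤ ∑ m ∈ Finset.range 2, y ^ m / m.factorial := by
            refine Finset.sum_le_sum_of_subset_of_nonneg ?_ fun _ _ _ => by positivity
            intro m hm
            exact Finset.mem_range.2 (Finset.mem_filter.1 hm).2
        _ = 1 + y := by simp [Finset.sum_range_succ]
    have h3 : ∑ m ∈ Finset.range (N + 1), y ^ m / m.factorial ≤ Real.exp y :=
      Real.sum_le_exp_of_nonneg hy _
    have h4 := Real.quadratic_le_exp_of_nonneg hy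
    calc _ ≤ ∑ m ∈ Finset.range (N + 1), ((1 - p) * (y ^ m / m.factorial) +
          p * (if m < 2 then y ^ m / m.factorial else 0)) := Finset.sum_le_sum h1
      _ = (1 - p) * ∑ m ∈ Finset.range (N + 1), y ^ m / m.factorial +
          p * ∑ m ∈ Finset.range (N + 1), (if m < 2 then y ^ m / m.factorial else 0) := by
          rw [Finset.sum_add_distrib, Finset.mul_sum, Finset.mul_sum]
      _ ≤ (1 - p) * Real.exp y + p * (1 + y) := by gcongr
      _ ≤ Real.exp y - p * (y ^ 2 / 2) := by nlinarith
      _ = Real.exp y * (1 - p * y ^ 2 * (Real.exp (-y) / 2)) := by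
          rw [Real.exp_neg]; field_simp
      _ ≤ Real.exp y * Real.exp (-(p * y ^ 2 * (Real.exp (-y) / 2))) := by
          gcongr
          exact Real.one_sub_le_exp_neg _
      _ = Real.exp (y - p * y ^ 2 * (Real.exp (-y) / 2)) := by rw [← Real.exp_add]; ring_nf
      _ ≤ _ := by
          apply Real.exp_le_exp.2
          have h5 : Real.exp (-(4 / ε)) ≤ Real.exp (-y) := Real.exp_le_exp.2 (by linarith)
          have h6 : c * min (p * y ^ 2) y ≤ Real.exp (-y) / 2 * (p * y ^ 2) := by
            gcongr
            · linarith
            · exact min_le_left _ _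
          linarith
  · -- For large `y`, replace the quadratic exponent by its tangent at `a`.
    have hε1 : 1 ≤ ε * y / 4 := by
      rw [div_le_iff₀ hε0] at hyY
      linarith
    set b := min (ε * y / 4) (1 / p) with hb
    have hb1 : 1 ≤ b := le_min hε1 (by rw [le_div_iff₀ hp]; linarith)
    set a := ⌊b⌋₊ with ha
    have hab : (a : ℝ) ≤ b := Nat.floor_le (by linarith)
    have ha1 : 1 ≤ a := Nat.le_floor (by simpa using hb1)
    have ha1' : (1 : ℝ) ≤ a := by exact_mod_cast ha1
    have hba : b / 2 ≤ a := by
      have := Nat.lt_floor_add_one b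
      rw [← ha] at this
      linarith
    have hpa : p * a ≤ 1 := by
      calc p * a ≤ p * (1 / p) := by gcongr; exact hab.trans (min_le_right _ _)
        _ = 1 := by field_simp
    have hae : (a : ℝ) ≤ ε * y / 4 := hab.trans (min_le_left _ _)
    have htan : ∀ m : ℕ, a * m ≤ m.choose 2 + (a + 1).choose 2 := by
      intro m
      have e1 := Nat.cast_choose_two ℚ m
      have e2 := Nat.cast_choose_two ℚ (a + 1)
      have : ((a * m : ℕ) : ℚ) ≤ ((m.choose 2 + (a + 1).choose 2 : ℕ) : ℚ) := by
        push_cast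
        rw [e1, e2]
        push_cast
        have h : (0 : ℤ) ≤ ((m : ℤ) - a) * ((m : ℤ) - a - 1) := by
          rcases lt_or_ge (a : ℤ) m with h | h
          · exact mul_nonneg (by linarith) (by linarith)
          · exact mul_nonneg_of_nonpos_of_nonpos (by linarith) (by linarith)
        have h' : (0 : ℚ) ≤ ((m : ℚ) - a) * ((m : ℚ) - a - 1) := by exact_mod_cast h
        linarith
      exact_mod_cast this
    have hlow : Real.exp (-(p / ε) * a ^ 2) ≤ (1 - p) ^ ((a + 1).choose 2) := by
      have h1 : Real.exp (-(p / ε)) ≤ 1 - p := by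
        rw [← Real.le_log_iff_exp_le hq0]
        have h2 := Real.one_sub_inv_le_log_of_pos hq0
        have h3 : 1 - (1 - p)⁻¹ = -(p / (1 - p)) := by field_simp; ring
        have h4 : p / (1 - p) ≤ p / ε := by gcongr; linarith
        linarith
      have h5 : (((a + 1).choose 2 : ℕ) : ℝ) ≤ (a : ℝ) ^ 2 := by
        rw [Nat.cast_choose_two]; push_cast; nlinarith
      calc Real.exp (-(p / ε) * a ^ 2) ≤ Real.exp (((a + 1).choose 2 : ℕ) * -(p / ε)) := by
            apply Real.exp_le_exp.2
            have : 0 ≤ p / ε := by positivity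
            nlinarith
        _ = Real.exp (-(p / ε)) ^ ((a + 1).choose 2) := Real.exp_nat_mul _ _
        _ ≤ _ := by gcongr
    have hqa : (1 - p) ^ a ≤ 1 - p * a / 2 := by
      calc (1 - p) ^ a ≤ Real.exp (-p) ^ a := by gcongr; exact Real.one_sub_le_exp_neg p
        _ = Real.exp (-(p * a)) := by rw [← Real.exp_nat_mul]; ring_nf
        _ ≤ 1 - p * a / 2 := by
            have h0 : 0 ≤ p * a := by positivity
            have h1 : Real.exp (-(p * a)) ≤ 1 / (1 + p * a) := by
              rw [Real.exp_neg, ← one_div]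
              gcongr
              linarith [Real.add_one_le_exp (p * a)]
            refine h1.trans ?_
            rw [div_le_iff₀ (by positivity)]
            nlinarith
    have hsum : Real.exp (-(p / ε) * a ^ 2) *
        ∑ m ∈ Finset.range (N + 1), y ^ m / m.factorial * (1 - p) ^ (m.choose 2) ≤
          Real.exp (y * (1 - p) ^ a) := by
      calc _ ≤ (1 - p) ^ ((a + 1).choose 2) *
          ∑ m ∈ Finset.range (N + 1), y ^ m / m.factorial * (1 - p) ^ (m.choose 2) := by
            gcongr
        _ = ∑ m ∈ Finset.range (N + 1), y ^ m / m.factorial *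
              (1 - p) ^ (m.choose 2 + (a + 1).choose 2) := by
            rw [Finset.mul_sum]
            refine Finset.sum_congr rfl fun m _ => ?_
            rw [pow_add]; ring
        _ ≤ ∑ m ∈ Finset.range (N + 1), (y * (1 - p) ^ a) ^ m / m.factorial := by
            refine Finset.sum_le_sum fun m _ => ?_
            rw [mul_pow, ← pow_mul, mul_div_right_comm]
            gcongr y ^ m / m.factorial * ?_
            exact pow_le_pow_of_le_one hq0.le hq1 (htan m)
        _ ≤ _ := Real.sum_le_exp_of_nonneg (by positivity) _
    have hmain : y * (1 - p) ^ a + p / ε * a ^ 2 ≤ y - c * min (p * y ^ 2) y := by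
      have h1 : y * (1 - p) ^ a ≤ y - p * a * y / 2 := by nlinarith
      have h2 : p / ε * a ^ 2 ≤ p * a * y / 4 := by
        have : (a : ℝ) / ε ≤ y / 4 := by rw [div_le_iff₀ hε0]; linarith
        calc p / ε * a ^ 2 = p * a * (a / ε) := by ring
          _ ≤ p * a * (y / 4) := by gcongr
          _ = _ := by ring
      have h3 : c * min (p * y ^ 2) y ≤ p * a * y / 4 := by
        have h4 : p * y / 8 * b ≤ p * a * y / 4 := by
          have : 0 ≤ p * y := by positivity
          nlinarith
        refine le_trans ?_ h4
        rcases min_choice (ε * y / 4) (1 / p) with h | h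
        · rw [hb, h]
          calc c * min (p * y ^ 2) y ≤ ε / 32 * (p * y ^ 2) := by
                gcongr
                exact min_le_left _ _
            _ = _ := by ring
        · rw [hb, h]
          calc c * min (p * y ^ 2) y ≤ 1 / 8 * y := by
                gcongr
                exact min_le_right _ _
            _ = _ := by field_simp
      linarith
    have h7 : ∑ m ∈ Finset.range (N + 1), y ^ m / m.factorial * (1 - p) ^ (m.choose 2) ≤
        Real.exp (y * (1 - p) ^ a + p / ε * a ^ 2) := by
      rw [neg_mul, Real.exp_neg, inv_mul_le_iff₀ (Real.exp_pos _)] at hsum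
      rwa [Real.exp_add, mul_comm]
    exact h7.trans (Real.exp_le_exp.2 hmain)

namespace SimpleGraph

open scoped Classical in
lemma ncard_agreeingPairs {Ω ι : Type*} [Fintype Ω] [Fintype ι] (χ : Ω → ι) :
    (agreeingPairs χ).ncard = ∑ i, ((Finset.univ.filter fun w => χ w = i).card).choose 2 := by
  have h : agreeingPairs χ = ((Finset.univ.biUnion fun i =>
      ((Finset.univ.filter fun w => χ w = i).offDiag.image Sym2.mk.uncurry) :
        Finset (Sym2 Ω)) : Set (Sym2 Ω)) := by
    ext z
    induction z using Sym2.ind with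
    | _ u v =>
      simp only [agreeingPairs, Set.mem_ofPred_eq, Finset.coe_biUnion, Finset.coe_univ,
        Set.mem_univ, Set.iUnion_true, Set.mem_iUnion, Finset.mem_coe, Finset.mem_image,
        Finset.mem_offDiag, Finset.mem_filter, Finset.mem_univ, true_and, Prod.exists]
      constructor
      · rintro ⟨h1, h2⟩
        exact ⟨χ v, u, v, ⟨by simpa using h2, rfl, by simpa using h1⟩, rfl⟩
      · rintro ⟨i, a, b, ⟨ha, hb, hab⟩, h⟩
        have h' : s(a, b) = s(u, v) := h
        rw [← h']
        refine ⟨by simpa using hab, ?_⟩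
        simp [ha, hb]
  rw [h, Set.ncard_coe_finset, Finset.card_biUnion]
  · exact Finset.sum_congr rfl fun i _ => Sym2.card_image_offDiag _
  · intro i _ j _ hij
    rw [Function.onFun, Finset.disjoint_left]
    intro z hz hz'
    simp only [Finset.mem_image, Finset.mem_offDiag, Finset.mem_filter, Finset.mem_univ, true_and,
      Prod.exists] at hz hz'
    obtain ⟨a, b, ⟨ha, hb, -⟩, rfl⟩ := hz
    obtain ⟨a', b', ⟨ha', hb', -⟩, h⟩ := hz'
    have h' : s(a', b') = s(a, b) := h
    rcases Sym2.eq_iff.1 h' with ⟨h1, -⟩ | ⟨h1, -⟩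
    · exact hij (ha.symm.trans ((congrArg χ h1.symm).trans ha'))
    · exact hij (hb.symm.trans ((congrArg χ h1.symm).trans ha'))

open scoped Classical in
/-- If `N` independent samples from the distribution `x` are joined pairwise with probability `p`,
then the probability that no two equal samples are joined is at most
`e N exp (-c ∑ i, min (p (N x i)²) (N x i))`. -/
lemma exists_collision_bound {ε : ℝ} (hε0 : 0 < ε) :
    ∃ c : ℝ, 0 < c ∧ ∀ (p : ℝ), 0 < p → p ≤ 1 - ε →
      ∀ {Ω ι : Type} [Fintype Ω] [Fintype ι] [Nonempty Ω] (x : ι → ℝ), (∀ i, 0 ≤ x i) →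
        ∑ i, x i = 1 →
        ∑ χ : Ω → ι, (∏ w, x (χ w)) * (1 - p) ^ (agreeingPairs χ).ncard ≤
          Real.exp 1 * Fintype.card Ω * Real.exp (-(c * ∑ i,
            min (p * (Fintype.card Ω * x i) ^ 2) (Fintype.card Ω * x i))) := by
  obtain ⟨c, hc, hbound⟩ := exists_poisson_collision_bound hε0
  refine ⟨c, hc, ?_⟩
  intro p hp hpε Ω ι _ _ _ x hx hx1
  have hq0 : 0 < 1 - p := by linarith
  set N := Fintype.card Ω with hN
  have hN1 : 1 ≤ N := Fintype.card_pos
  have hN0 : (0 : ℝ) < N := by exact_mod_cast hN1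
  have h1 := sum_prod_occupation_le (Ω := Ω) x hx (fun _ m => (1 - p) ^ (m.choose 2))
    (fun _ _ => by positivity)
  simp_rw [Finset.prod_pow_eq_pow_sum, ← ncard_agreeingPairs] at h1
  rw [← hN] at h1
  have h2 : ∏ i, ∑ m ∈ Finset.range (N + 1), (N * x i) ^ m / m.factorial * (1 - p) ^ (m.choose 2) ≤
      Real.exp N * Real.exp (-(c * ∑ i, min (p * (N * x i) ^ 2) (N * x i))) := by
    calc _ ≤ ∏ i, Real.exp (N * x i - c * min (p * (N * x i) ^ 2) (N * x i)) := by
          refine Finset.prod_le_prod (fun i _ => Finset.sum_nonneg fun m _ => ?_) fun i _ => ?_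
          · have := hx i
            positivity
          · exact hbound p _ N hp hpε (mul_nonneg hN0.le (hx i))
      _ = _ := by
          rw [← Real.exp_sum, ← Real.exp_add, Finset.sum_sub_distrib, ← Finset.mul_sum,
            ← Finset.mul_sum, hx1]
          ring_nf
  have h3 := factorial_mul_exp_le hN1
  have hNN : (0 : ℝ) < (N : ℝ) ^ N := by positivity
  refine le_of_mul_le_mul_left (h1.trans ?_) hNN
  calc _ ≤ (N.factorial : ℝ) * (Real.exp N *
        Real.exp (-(c * ∑ i, min (p * (N * x i) ^ 2) (N * x i)))) := by gcongr
    _ = (N.factorial * Real.exp N) *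
        Real.exp (-(c * ∑ i, min (p * (N * x i) ^ 2) (N * x i))) := by ring
    _ ≤ (Real.exp 1 * N * (N : ℝ) ^ N) *
        Real.exp (-(c * ∑ i, min (p * (N * x i) ^ 2) (N * x i))) := by gcongr
    _ = _ := by ring

end SimpleGraph

end Collisions

lemma min_le_sum_min_of_card {ι : Type*} [Fintype ι] [Nonempty ι] {p N : ℝ} (hp : 0 < p)
    (hN : 0 < N) {x : ι → ℝ} (hx : ∀ i, 0 ≤ x i) (hx1 : ∑ i, x i = 1) :
    min (p * N ^ 2 / Fintype.card ι) (N / 2) ≤ ∑ i, min (p * (N * x i) ^ 2) (N * x i) := by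
  set K : ℝ := (Fintype.card ι : ℝ) with hK
  have hK0 : 0 < K := by rw [hK]; exact_mod_cast Fintype.card_pos
  -- Both functions in the minimum lie above the same line, a tangent of the parabola.
  have key : ∀ a : ℝ, 0 ≤ a → a ≤ 1 / 2 →
      2 * a * N - a ^ 2 * K / p ≤ ∑ i, min (p * (N * x i) ^ 2) (N * x i) := by
    intro a ha0 ha
    have : 2 * a * N - a ^ 2 * K / p = ∑ i, (2 * a * N * x i - a ^ 2 / p) := by
      rw [Finset.sum_sub_distrib, ← Finset.mul_sum, hx1, Finset.sum_const, Finset.card_univ,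
        nsmul_eq_mul, hK]
      ring
    rw [this]
    refine Finset.sum_le_sum fun i _ => le_min ?_ ?_
    · have h : 0 ≤ (p * (N * x i) - a) ^ 2 / p := by positivity
      have h2 : (p * (N * x i) - a) ^ 2 / p =
          p * (N * x i) ^ 2 - (2 * a * N * x i - a ^ 2 / p) := by
        field_simp; ring
      linarith
    · have h : 0 ≤ a ^ 2 / p := by positivity
      have h2 : 0 ≤ N * x i := mul_nonneg hN.le (hx i)
      nlinarith
  rcases le_total (p * N / K) (1 / 2) with h | h
  · refine (min_le_left _ _).trans ((le_of_eq ?_).trans (key (p * N / K) (by positivity) h))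
    field_simp; ring
  · refine (min_le_right _ _).trans (le_trans ?_ (key (1 / 2) (by norm_num) le_rfl))
    rw [div_le_div_iff₀ (by norm_num) hK0] at h
    have : (1 / 2 : ℝ) ^ 2 * K / p ≤ N / 2 := by
      rw [div_le_iff₀ hp]
      nlinarith
    linarith

lemma min_le_sum_min_of_sum_sq {ι : Type*} [Fintype ι] {p N : ℝ} (hN : 0 < N)
    {x : ι → ℝ} (hx : ∀ i, 0 ≤ x i) (hβ : 0 < ∑ i, x i ^ 2) :
    min (p * N ^ 2 * ∑ i, x i ^ 2) (N * √(∑ i, x i ^ 2)) ≤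
      ∑ i, min (p * (N * x i) ^ 2) (N * x i) := by
  set β := ∑ i, x i ^ 2 with hβd
  have hs : 0 < √β := Real.sqrt_pos.2 hβ
  have h1 : N * √β = N / √β * β := by
    rw [div_mul_eq_mul_div, eq_div_iff hs.ne', mul_assoc, Real.mul_self_sqrt hβ.le]
  rw [h1, ← min_mul_of_nonneg _ _ hβ.le, hβd, Finset.mul_sum]
  refine Finset.sum_le_sum fun i _ => le_min ?_ ?_
  · calc _ ≤ p * N ^ 2 * x i ^ 2 := by gcongr; exact min_le_left _ _
      _ = _ := by ring
  · have hxi : x i ≤ √β := by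
      refine Real.le_sqrt_of_sq_le ?_
      exact Finset.single_le_sum (f := fun i => x i ^ 2) (fun i _ => by positivity)
        (Finset.mem_univ i)
    calc _ ≤ N / √β * x i ^ 2 := by gcongr; exact min_le_right _ _
      _ = N * x i * (x i / √β) := by ring
      _ ≤ N * x i * 1 := by
          have := hx i
          gcongr
          rw [div_le_one hs]
          exact hxi
      _ = _ := by ring

/-! ### The union bound over colourings -/

namespace SimpleGraph

/-- Only the small classes of a set colouring matter, up to few exceptional vertices: if any two
disjoint sets of size `s` are joined by an edge, then a class with at least `s` vertices is seen
by all but `2 s` vertices. Removing these vertices together with the classes of size less than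
`s`, the remaining vertices are told apart by the colours seen among the removed ones. -/
lemma exists_seenFrom_of_isSetColoring {n k s : ℕ} {G : SimpleGraph (Fin n)} {c : Fin n → Fin k}
    (hc : G.IsSetColoring c) (hn : k * (2 * s) ≤ n)
    (hG : ∀ T M : Finset (Fin n), T.card = s → M.card = s → Disjoint T M →
      ∃ t ∈ T, ∃ m ∈ M, G.Adj t m) :
    ∃ (ρ : Fin (k * (2 * s)) ↪ Fin n) (τ : Fin (k * (2 * s)) → Option (Fin k)),
      ∀ u v, (∀ j, u ≠ ρ j) → (∀ j, v ≠ ρ j) → G.Adj u v →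
        seenFrom ρ τ G u ≠ seenFrom ρ τ G v := by
  classical
  have h1 : ∀ i : Fin k, ∃ R : Finset (Fin n), R.card ≤ 2 * s ∧
      ((∀ u, c u = i → u ∈ R) ∨ ∀ v ∉ R, ∃ u, c u = i ∧ G.Adj v u) := by
    intro i
    set K := Finset.univ.filter fun u => c u = i with hK
    rcases lt_or_ge K.card s with h | h
    · exact ⟨K, by omega, Or.inl fun u hu => by simp [hK, hu]⟩
    · obtain ⟨T, hTK, hT⟩ := Finset.exists_subset_card_eq h
      set M := Finset.univ.filter fun v => v ∉ T ∧ ∀ t ∈ T, ¬ G.Adj t v with hM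
      have hMs : M.card < s := by
        by_contra hcon
        obtain ⟨M', hM', hMs'⟩ := Finset.exists_subset_card_eq (not_lt.1 hcon)
        obtain ⟨t, ht, m, hm, hadj⟩ := hG T M' hT hMs' (Finset.disjoint_right.2 fun m hm =>
          (Finset.mem_filter.1 (hM' hm)).2.1)
        exact (Finset.mem_filter.1 (hM' hm)).2.2 t ht hadj
      refine ⟨T ∪ M, (Finset.card_union_le _ _).trans (by omega), Or.inr fun v hv => ?_⟩
      rw [Finset.mem_union, not_or] at hv
      have h2 : ∃ t ∈ T, G.Adj t v := by
        by_contra hcon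
        push Not at hcon
        exact hv.2 (by simp only [hM, Finset.mem_filter, Finset.mem_univ, true_and]
                       exact ⟨hv.1, hcon⟩)
      obtain ⟨t, ht, hadj⟩ := h2
      exact ⟨t, (Finset.mem_filter.1 (hTK ht)).2, hadj.symm⟩
  choose R hRcard hR using h1
  have hcard : (Finset.univ.biUnion R).card ≤ k * (2 * s) := by
    refine Finset.card_biUnion_le.trans ?_
    calc _ ≤ ∑ _i : Fin k, 2 * s := Finset.sum_le_sum fun i _ => hRcard i
      _ = _ := by simp
  obtain ⟨R', hRR', hR'⟩ := Finset.exists_superset_card_eq hcard (by simpa using hn)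
  set ρ : Fin (k * (2 * s)) ↪ Fin n := (R'.orderEmbOfFin hR').toEmbedding with hρ
  have hρmem : ∀ v, (∃ j, ρ j = v) ↔ v ∈ R' := by
    intro v
    have := Finset.range_orderEmbOfFin R' hR'
    rw [← Finset.mem_coe, ← this]
    rfl
  set τ : Fin (k * (2 * s)) → Option (Fin k) := fun j =>
    if ∀ u, c u = c (ρ j) → u ∈ R (c (ρ j)) then some (c (ρ j)) else none with hτ
  have hseen : ∀ v i, i ∈ seenFrom ρ τ G v ↔ (∀ u, c u = i → u ∈ R i) ∧
      i ∈ G.neighborColorSet c v := by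
    intro v i
    simp only [seenFrom, seenColors, Finset.mem_filter, Finset.mem_univ, true_and,
      decide_eq_true_eq, neighborColorSet, Set.mem_image, mem_neighborSet]
    constructor
    · rintro ⟨j, hj, hadj⟩
      simp only [hτ] at hj
      split_ifs at hj with hsmall
      obtain rfl := Option.some.inj hj
      exact ⟨hsmall, ρ j, hadj, rfl⟩
    · rintro ⟨hsmall, u, hadj, rfl⟩
      obtain ⟨j, hj⟩ := (hρmem u).2 (hRR' (Finset.mem_biUnion.2
        ⟨c u, Finset.mem_univ _, hsmall u rfl⟩))
      refine ⟨j, ?_, hj ▸ hadj⟩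
      simp only [hτ, hj]
      rw [if_pos hsmall]
  have hlarge : ∀ v, (∀ j, v ≠ ρ j) → ∀ i, ¬ (∀ u, c u = i → u ∈ R i) →
      i ∈ G.neighborColorSet c v := by
    intro v hv i hi
    have hvR : v ∉ R i := by
      intro h
      obtain ⟨j, hj⟩ := (hρmem v).2 (hRR' (Finset.mem_biUnion.2 ⟨i, Finset.mem_univ _, h⟩))
      exact hv j hj.symm
    obtain ⟨u, hu, hadj⟩ := (hR i).resolve_left hi v hvR
    exact ⟨u, hadj, hu⟩
  refine ⟨ρ, τ, fun u v hu hv hadj heq => hc hadj ?_⟩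
  ext i
  by_cases hi : ∀ u, c u = i → u ∈ R i
  · have h1 := hseen u i
    have h2 := hseen v i
    rw [heq] at h1
    exact ⟨fun h => (h2.1 (h1.2 ⟨hi, h⟩)).2, fun h => (h1.1 (h2.2 ⟨hi, h⟩)).2⟩
  · exact ⟨fun _ => hlarge v hv i hi, fun _ => hlarge u hu i hi⟩

lemma binomialRandom_no_edge_between {V : Type*} [Finite V] (p : I) {T M : Finset V}
    (h : Disjoint T M) :
    (binomialRandom V p).real {G | ∀ t ∈ T, ∀ m ∈ M, ¬ G.Adj t m} =
      (1 - (p : ℝ)) ^ (T.card * M.card) := by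
  have hne : ∀ t ∈ T, ∀ m ∈ M, t ≠ m := fun t ht m hm htm =>
    Finset.disjoint_left.1 h ht (htm ▸ hm)
  have := binomialRandom_edge_pattern (V := V) p (fun x : T × M => s((x.1 : V), (x.2 : V))) ?_ ?_
    (fun _ => false)
  · simp only [Bool.false_eq_true, iff_false, mem_edgeSet, Prod.forall, Subtype.forall,
      Finset.prod_const, Finset.card_univ, Fintype.card_prod, Fintype.card_coe,
      bernoulliWeight, if_false] at this
    exact this
  · rintro ⟨⟨t, ht⟩, ⟨m, hm⟩⟩ ⟨⟨t', ht'⟩, ⟨m', hm'⟩⟩ heq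
    rcases Sym2.eq_iff.1 heq with ⟨h1, h2⟩ | ⟨h1, h2⟩
    · simp only at h1 h2
      subst h1 h2
      rfl
    · exact absurd h1 (hne _ ht _ hm')
  · rintro ⟨⟨t, ht⟩, ⟨m, hm⟩⟩
    simpa using hne _ ht _ hm

/-- Union bound over the colourings of the small classes. -/
lemma binomialRandom_exists_isSetColoring_le {n k s : ℕ} (p : I) (hn : k * (2 * s) ≤ n) {δ : ℝ}
    (hδ : ∀ (ρ : Fin (k * (2 * s)) ↪ Fin n) (τ : Fin (k * (2 * s)) → Option (Fin k)),
      (binomialRandom (Fin n) p).real {G | ∀ u v, (∀ j, u ≠ ρ j) → (∀ j, v ≠ ρ j) → G.Adj u v →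
        seenFrom ρ τ G u ≠ seenFrom ρ τ G v} ≤ δ) :
    (binomialRandom (Fin n) p).real {G | ∃ c : Fin n → Fin k, G.IsSetColoring c} ≤
      (n : ℝ) ^ (2 * s) * (1 - (p : ℝ)) ^ (s * s) +
        (n : ℝ) ^ (k * (2 * s)) * ((k : ℝ) + 1) ^ (k * (2 * s)) * δ := by
  classical
  set μ := binomialRandom (Fin n) p with hμ
  set P := (Finset.univ : Finset (Fin n)).powersetCard s with hP
  set B : Finset (Fin n) × Finset (Fin n) → Set (SimpleGraph (Fin n)) := fun x =>
    {G | Disjoint x.1 x.2 ∧ ∀ t ∈ x.1, ∀ m ∈ x.2, ¬ G.Adj t m} with hB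
  set D : (Fin (k * (2 * s)) ↪ Fin n) × (Fin (k * (2 * s)) → Option (Fin k)) →
    Set (SimpleGraph (Fin n)) := fun x => {G | ∀ u v, (∀ j, u ≠ x.1 j) → (∀ j, v ≠ x.1 j) →
      G.Adj u v → seenFrom x.1 x.2 G u ≠ seenFrom x.1 x.2 G v} with hD
  have hsub : {G : SimpleGraph (Fin n) | ∃ c : Fin n → Fin k, G.IsSetColoring c} ⊆
      (⋃ x ∈ P ×ˢ P, B x) ∪ ⋃ x ∈ Finset.univ, D x := by
    rintro G ⟨c, hc⟩
    by_cases hG : ∀ T M : Finset (Fin n), T.card = s → M.card = s → Disjoint T M →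
      ∃ t ∈ T, ∃ m ∈ M, G.Adj t m
    · right
      obtain ⟨ρ, τ, h⟩ := exists_seenFrom_of_isSetColoring hc hn hG
      exact Set.mem_biUnion (Finset.mem_coe.2 (Finset.mem_univ (ρ, τ))) h
    · left
      push Not at hG
      obtain ⟨T, M, hT, hM, hTM, h⟩ := hG
      refine Set.mem_biUnion (x := (T, M)) ?_ ⟨hTM, h⟩
      simp [hP, Finset.mem_powersetCard, hT, hM]
  have hq0 : 0 ≤ 1 - (p : ℝ) := by linarith [p.2.2]
  have hδ0 : 0 ≤ δ := measureReal_nonneg.trans (hδ (Fin.castLEEmb hn) fun _ => none)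
  calc μ.real {G | ∃ c : Fin n → Fin k, G.IsSetColoring c}
      ≤ μ.real ((⋃ x ∈ P ×ˢ P, B x) ∪ ⋃ x ∈ Finset.univ, D x) := measureReal_mono hsub
    _ ≤ μ.real (⋃ x ∈ P ×ˢ P, B x) + μ.real (⋃ x ∈ Finset.univ, D x) := measureReal_union_le _ _
    _ ≤ ∑ x ∈ P ×ˢ P, μ.real (B x) + ∑ x, μ.real (D x) :=
        add_le_add (measureReal_biUnion_finset_le _ _) (measureReal_biUnion_finset_le _ _)
    _ ≤ ∑ _x ∈ P ×ˢ P, (1 - (p : ℝ)) ^ (s * s) + ∑ _x : (Fin (k * (2 * s)) ↪ Fin n) ×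
          (Fin (k * (2 * s)) → Option (Fin k)), δ := by
        refine add_le_add (Finset.sum_le_sum fun x hx => ?_)
          (Finset.sum_le_sum fun x _ => hδ x.1 x.2)
        rw [Finset.mem_product, hP, Finset.mem_powersetCard, Finset.mem_powersetCard] at hx
        by_cases hd : Disjoint x.1 x.2
        · have := binomialRandom_no_edge_between p hd
          rw [hx.1.2, hx.2.2] at this
          rw [← this]
          exact measureReal_mono fun G hG => hG.2
        · have : B x = ∅ := by
            ext G
            simp [hB, hd]
          rw [this, measureReal_empty]
          positivity
    _ ≤ _ := by
        rw [Finset.sum_const, Finset.sum_const, nsmul_eq_mul, nsmul_eq_mul]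
        have h1 : (((P ×ˢ P).card : ℕ) : ℝ) ≤ (n : ℝ) ^ (2 * s) := by
          rw [Finset.card_product, hP, Finset.card_powersetCard, Finset.card_univ,
            Fintype.card_fin, two_mul, pow_add]
          push_cast
          have : ((n.choose s : ℕ) : ℝ) ≤ (n : ℝ) ^ s := by exact_mod_cast Nat.choose_le_pow n s
          gcongr
        have h2 : (((Finset.univ : Finset ((Fin (k * (2 * s)) ↪ Fin n) ×
            (Fin (k * (2 * s)) → Option (Fin k)))).card : ℕ) : ℝ) ≤
            (n : ℝ) ^ (k * (2 * s)) * ((k : ℝ) + 1) ^ (k * (2 * s)) := by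
          rw [Finset.card_univ, Fintype.card_prod, Fintype.card_embedding_eq, Fintype.card_fun,
            Fintype.card_option, Fintype.card_fin, Fintype.card_fin, Fintype.card_fin]
          push_cast
          have : ((n.descFactorial (k * (2 * s)) : ℕ) : ℝ) ≤ (n : ℝ) ^ (k * (2 * s)) := by
            exact_mod_cast Nat.descFactorial_le_pow n _
          gcongr
        gcongr

open scoped Classical in
/-- If for every colouring of the removed vertices the collision exponent is at least `M`, and `M`
exceeds the entropy of these colourings, then there is hardly ever a set colouring with `k`
colours. -/
lemma exists_binomialRandom_setColoring_bound {ε : ℝ} (hε0 : 0 < ε) :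
    ∃ c : ℝ, 0 < c ∧ ∀ (p : I) (n k s : ℕ) (M : ℝ), 0 < (p : ℝ) → (p : ℝ) ≤ 1 - ε → 2 ≤ n →
      3 * Real.log n ≤ p * s → 4 * (k * s) ≤ n → k + 1 ≤ n →
      (∀ τ : Fin (k * (2 * s)) → Option (Fin k), M ≤ ∑ S : Finset (Fin k),
        min ((p : ℝ) * (n / 2 * seenProb p τ S) ^ 2) (n / 2 * seenProb p τ S)) →
      4 * (k * s) * Real.log n + 2 * Real.log n + 1 ≤ c * M →
      (binomialRandom (Fin n) p).real {G | ∃ c : Fin n → Fin k, G.IsSetColoring c} ≤ 2 / n := by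
  obtain ⟨c, hc, hbound⟩ := exists_collision_bound hε0
  refine ⟨c, hc, ?_⟩
  intro p n k s M hp hpε hn2 hs hks hkn hM hcM
  have hn0 : (0 : ℝ) < n := by exact_mod_cast (by omega : 0 < n)
  have hL : 0 < Real.log n := Real.log_pos (by exact_mod_cast (by omega : 1 < n))
  have hq0 : 0 ≤ 1 - (p : ℝ) := by linarith
  set r := k * (2 * s) with hr
  have hrn : 2 * r ≤ n := by rw [hr]; linarith
  have hs1 : (1 : ℝ) ≤ s := by
    by_contra hcon
    have : s = 0 := by
      by_contra h0
      exact hcon (by exact_mod_cast Nat.one_le_iff_ne_zero.2 h0)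
    rw [this] at hs
    simp at hs
    linarith
  have hδ : ∀ (ρ : Fin r ↪ Fin n) (τ : Fin r → Option (Fin k)),
      (binomialRandom (Fin n) p).real {G | ∀ u v, (∀ j, u ≠ ρ j) → (∀ j, v ≠ ρ j) → G.Adj u v →
        seenFrom ρ τ G u ≠ seenFrom ρ τ G v} ≤ Real.exp 1 * n * Real.exp (-(c * M)) := by
    intro ρ τ
    have hcard : Fintype.card {v : Fin n // ∀ j, v ≠ ρ j} = n - r := by
      rw [Fintype.card_subtype]
      have : (Finset.univ.filter fun v : Fin n => ∀ j, v ≠ ρ j) =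
          Finset.univ \ Finset.univ.map ρ := by
        ext v
        simp [eq_comm]
      rw [this, Finset.card_sdiff_of_subset (Finset.subset_univ _)]
      simp
    have hcardR : (n : ℝ) / 2 ≤ Fintype.card {v : Fin n // ∀ j, v ≠ ρ j} := by
      rw [hcard, Nat.cast_sub (by omega)]
      have : (2 * r : ℝ) ≤ n := by exact_mod_cast hrn
      linarith
    have hcardR' : (Fintype.card {v : Fin n // ∀ j, v ≠ ρ j} : ℝ) ≤ n := by
      rw [hcard]
      exact_mod_cast Nat.sub_le _ _
    have : Nonempty {v : Fin n // ∀ j, v ≠ ρ j} := by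
      rw [← Fintype.card_pos_iff, hcard]
      omega
    have h1 := binomialRandom_adj_imp_seenFrom_ne p ρ.injective τ
      (ω := fun w : {v : Fin n // ∀ j, v ≠ ρ j} => (w : Fin n)) Subtype.val_injective
      (fun w j => w.2 j)
    have h2 := hbound p hp hpε (Ω := {v : Fin n // ∀ j, v ≠ ρ j}) (seenProb p τ)
      (seenProb_nonneg p τ) (sum_seenProb p τ)
    have h3 : {G : SimpleGraph (Fin n) | ∀ u v, (∀ j, u ≠ ρ j) → (∀ j, v ≠ ρ j) → G.Adj u v →
        seenFrom ρ τ G u ≠ seenFrom ρ τ G v} = {G | ∀ u v : {v : Fin n // ∀ j, v ≠ ρ j},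
          G.Adj u v → seenFrom ρ τ G u ≠ seenFrom ρ τ G v} := by
      ext G
      simp only [Set.mem_ofPred_eq, Subtype.forall]
      exact ⟨fun h u hu v hv => h u v hu hv, fun h u v hu hv => h u hu v hv⟩
    rw [h3, h1]
    refine h2.trans ?_
    have h4 : M ≤ ∑ S : Finset (Fin k),
        min ((p : ℝ) * (Fintype.card {v : Fin n // ∀ j, v ≠ ρ j} * seenProb p τ S) ^ 2)
          (Fintype.card {v : Fin n // ∀ j, v ≠ ρ j} * seenProb p τ S) := by
      refine (hM τ).trans (Finset.sum_le_sum fun S _ => ?_)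
      have := seenProb_nonneg p τ S
      refine min_le_min ?_ ?_ <;> gcongr
    gcongr
  refine (binomialRandom_exists_isSetColoring_le p (by omega) hδ).trans ?_
  have hexp : ∀ m : ℕ, (n : ℝ) ^ m = Real.exp (m * Real.log n) := fun m => by
    rw [Real.exp_nat_mul, Real.exp_log hn0]
  have hinv : Real.exp (-Real.log n) = 1 / n := by
    rw [Real.exp_neg, Real.exp_log hn0, one_div]
  have e1 : (n : ℝ) ^ (2 * s) * (1 - (p : ℝ)) ^ (s * s) ≤ 1 / n := by
    calc _ ≤ Real.exp ((2 * s : ℕ) * Real.log n) * Real.exp (-p) ^ (s * s) := by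
          rw [hexp]
          gcongr
          exact Real.one_sub_le_exp_neg _
      _ = Real.exp (2 * s * Real.log n - s * (p * s)) := by
          rw [← Real.exp_nat_mul, ← Real.exp_add]
          push_cast
          ring_nf
      _ ≤ Real.exp (-Real.log n) := by
          apply Real.exp_le_exp.2
          nlinarith
      _ = _ := hinv
  have e2 : (n : ℝ) ^ r * ((k : ℝ) + 1) ^ r * (Real.exp 1 * n * Real.exp (-(c * M))) ≤ 1 / n := by
    have hk : ((k : ℝ) + 1) ≤ n := by exact_mod_cast hkn
    calc _ ≤ (n : ℝ) ^ r * (n : ℝ) ^ r * (Real.exp 1 * n * Real.exp (-(c * M))) := by gcongr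
      _ = Real.exp (2 * r * Real.log n + 1 + Real.log n - c * M) := by
          rw [hexp]
          nth_rewrite 3 [← Real.exp_log hn0]
          rw [← Real.exp_add, ← Real.exp_add, ← Real.exp_add, ← Real.exp_add]
          ring_nf
      _ ≤ Real.exp (-Real.log n) := by
          apply Real.exp_le_exp.2
          have : (r : ℝ) = k * (2 * s) := by rw [hr]; push_cast; ring
          rw [this]
          linarith
      _ = _ := hinv
  calc _ ≤ 1 / (n : ℝ) + 1 / n := add_le_add e1 e2
    _ = 2 / n := by ring

end SimpleGraph

/-! ### The first moment bound -/

lemma agreeProb_zero_right (p : ℝ) : agreeProb p 0 = 1 := by simp [agreeProb]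

lemma agreeProb_nonneg (p : ℝ) (ℓ : ℕ) : 0 ≤ agreeProb p ℓ := by unfold agreeProb; positivity

lemma agreeProb_le_one (p : I) (ℓ : ℕ) : agreeProb p ℓ ≤ 1 := by
  have h0 : 0 ≤ (1 - (p : ℝ)) ^ ℓ := pow_nonneg (by linarith [p.2.2]) _
  have h1 : (1 - (p : ℝ)) ^ ℓ ≤ 1 := pow_le_one₀ (by linarith [p.2.2]) (by linarith [p.2.1])
  unfold agreeProb
  nlinarith

/-- For small `p` there is a class size for which agreement is almost as unlikely as for a fair
coin. -/
lemma exists_agreeProb_le {p : ℝ} (h0 : 0 < p) (h1 : p < 1) :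
    ∃ ℓ : ℕ, 0 < ℓ ∧ (ℓ : ℝ) ≤ 1 / p + 1 ∧ agreeProb p ℓ ≤ (1 + p ^ 2) / 2 := by
  classical
  have hex : ∃ ℓ : ℕ, (1 - p) ^ ℓ ≤ 1 / 2 := by
    obtain ⟨ℓ, hℓ⟩ := exists_pow_lt_of_lt_one (by norm_num : (0 : ℝ) < 1 / 2)
      (by linarith : 1 - p < 1)
    exact ⟨ℓ, hℓ.le⟩
  set ℓ := Nat.find hex with hℓ
  have hspec : (1 - p) ^ ℓ ≤ 1 / 2 := Nat.find_spec hex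
  have hpos : 0 < ℓ := by
    rw [Nat.pos_iff_ne_zero]
    intro h
    rw [h] at hspec
    norm_num at hspec
  obtain ⟨m, hm⟩ : ∃ m, ℓ = m + 1 := ⟨ℓ - 1, by omega⟩
  have hmin : 1 / 2 < (1 - p) ^ m := by
    have := Nat.find_min hex (m := m) (by rw [← hℓ]; omega)
    exact not_le.1 this
  refine ⟨ℓ, hpos, ?_, ?_⟩
  · have h2 : (1 - p) ^ m ≤ Real.exp (-(p * m)) := by
      calc (1 - p) ^ m ≤ Real.exp (-p) ^ m := by
            refine pow_le_pow_left₀ (by linarith) (Real.one_sub_le_exp_neg p) _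
        _ = _ := by rw [← Real.exp_nat_mul]; ring_nf
    have h3 : p * m ≤ 1 := by
      by_contra hcon
      have h4 : Real.exp (-(p * m)) ≤ Real.exp (-1) := Real.exp_le_exp.2 (by linarith)
      have h5 : Real.exp (-1) < 1 / 2 := by
        rw [Real.exp_neg, ← one_div]
        have := Real.add_one_lt_exp (one_ne_zero)
        exact one_div_lt_one_div_of_lt (by norm_num) (by linarith)
      linarith
    rw [hm]
    push_cast
    have : (m : ℝ) ≤ 1 / p := by rw [le_div_iff₀ h0]; linarith
    linarith
  · have h2 : (1 - p) / 2 ≤ (1 - p) ^ ℓ := by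
      rw [hm, pow_succ]
      nlinarith
    unfold agreeProb
    nlinarith

namespace SimpleGraph

lemma setChromaticNumber_le {V : Type*} {G : SimpleGraph V} {k : ℕ}
    (h : ∃ c : V → Fin k, G.IsSetColoring c) : G.setChromaticNumber ≤ k :=
  Nat.sInf_le h

/-- Every number of colours from `χ_s` on admits a set colouring: unused colours do no harm. -/
lemma exists_isSetColoring_of_le {n k : ℕ} {G : SimpleGraph (Fin n)}
    (h : G.setChromaticNumber ≤ k) : ∃ c : Fin n → Fin k, G.IsSetColoring c := by
  obtain ⟨c, hc⟩ := setChromaticNumber_mem G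
  refine ⟨fun v => Fin.castLE h (c v), fun u v huv heq => hc huv ?_⟩
  have hcomp : ∀ w, G.neighborColorSet (fun v => Fin.castLE h (c v)) w =
      Fin.castLE h '' G.neighborColorSet c w := fun w => by
    unfold neighborColorSet
    rw [Set.image_image]
  rw [hcomp, hcomp] at heq
  exact (Set.image_injective.2 (Fin.castLE_injective h)) heq

/-- The first moment bound for the colouring with `k` classes of size `ℓ`, in which the remaining
vertices share one further colour. For each pair of vertices, at least `k - 2` of the classes
contain neither of the two. -/
lemma binomialRandom_not_exists_isSetColoring_le (p : I) {n k ℓ : ℕ} (hℓ : 0 < ℓ)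
    (hn : k * ℓ ≤ n) :
    (binomialRandom (Fin n) p).real {G | ¬ ∃ c : Fin n → Fin (k + 1), G.IsSetColoring c} ≤
      (n : ℝ) ^ 2 * (p * agreeProb p ℓ ^ (k - 2)) := by
  classical
  set c : Fin n → Fin (k + 1) := fun v => ⟨min (v / ℓ) k, by omega⟩ with hc
  have hclass : ∀ i : Fin (k + 1), i ≠ Fin.last k → Fintype.card {w // c w = i} = ℓ := by
    intro i hi
    have hik : (i : ℕ) < k := by
      have h1 := i.2
      have h2 : (i : ℕ) ≠ k := fun h => hi (Fin.ext h)
      omega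
    have hub : (i : ℕ) * ℓ + ℓ ≤ n := by nlinarith
    have e : {w // c w = i} ≃ Fin ℓ :=
      { toFun := fun w => ⟨(w : Fin n) % ℓ, Nat.mod_lt _ hℓ⟩
        invFun := fun a => ⟨⟨i * ℓ + a, by have := a.2; omega⟩, by
          apply Fin.ext
          have : ((i : ℕ) * ℓ + a) / ℓ = i := by
            rw [Nat.add_comm, Nat.add_mul_div_right _ _ hℓ, Nat.div_eq_of_lt a.2, zero_add]
          simp only [hc, this]
          omega⟩
        left_inv := by
          rintro ⟨w, hw⟩
          apply Subtype.ext
          apply Fin.ext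
          have h1 : min ((w : ℕ) / ℓ) k = i := congrArg Fin.val hw
          have h2 : (w : ℕ) / ℓ = i := by omega
          simp only
          rw [← h2]
          exact Nat.div_add_mod' _ _
        right_inv := by
          intro a
          apply Fin.ext
          simp [Nat.mod_eq_of_lt a.2] }
    rw [Fintype.card_congr e, Fintype.card_fin]
  have hpair : ∀ u v : Fin n, (binomialRandom (Fin n) p).real
      {G | G.Adj u v ∧ G.neighborColorSet c u = G.neighborColorSet c v} ≤
        p * agreeProb p ℓ ^ (k - 2) := by
    intro u v
    by_cases huv : u = v
    · subst huv
      have : {G : SimpleGraph (Fin n) | G.Adj u u ∧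
          G.neighborColorSet c u = G.neighborColorSet c u} = ∅ := by
        ext G; simp
      rw [this, measureReal_empty]
      exact mul_nonneg p.2.1 (pow_nonneg (agreeProb_nonneg _ _) _)
    · -- The classes of `u` and `v` and the remainder class are not used to separate `u` from `v`.
      set Bad : Finset (Fin (k + 1)) := {c u, c v, Fin.last k} with hBad
      set ρ : {w // c w ∉ Bad} → Fin n := Subtype.val with hρ
      set τ : {w // c w ∉ Bad} → Option (Fin (k + 1)) := fun w => some (c w) with hτ
      have hkey := binomialRandom_adj_and_seenFrom_eq p (ρ := ρ) Subtype.val_injective τ huv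
        (fun j h => j.2 (by rw [show (j : Fin n) = u from h.symm]; simp [hBad]))
        (fun j h => j.2 (by rw [show (j : Fin n) = v from h.symm]; simp [hBad]))
      have hsub : {G : SimpleGraph (Fin n) | G.Adj u v ∧
          G.neighborColorSet c u = G.neighborColorSet c v} ⊆
          {G | G.Adj u v ∧ seenFrom ρ τ G u = seenFrom ρ τ G v} := by
        rintro G ⟨hadj, heq⟩
        refine ⟨hadj, ?_⟩
        have hseen : ∀ w i, i ∈ seenFrom ρ τ G w ↔ i ∉ Bad ∧ i ∈ G.neighborColorSet c w := by
          intro w i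
          simp only [seenFrom, seenColors, Finset.mem_filter, Finset.mem_univ, true_and,
            decide_eq_true_eq, neighborColorSet, Set.mem_image, mem_neighborSet, hτ,
            Option.some.injEq]
          constructor
          · rintro ⟨j, rfl, hj⟩
            exact ⟨j.2, j, hj, rfl⟩
          · rintro ⟨hb, x, hx, rfl⟩
            exact ⟨⟨x, hb⟩, rfl, hx⟩
        ext i
        rw [hseen, hseen, heq]
      refine (measureReal_mono hsub).trans (hkey.le.trans ?_)
      have hcard : ∀ i, agreeProb p (Fintype.card {j // τ j = some i}) =
          if i ∈ Bad then 1 else agreeProb p ℓ := by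
        intro i
        split_ifs with hi
        · rw [Fintype.card_eq_zero_iff.2, agreeProb_zero_right]
          constructor
          rintro ⟨j, hj⟩
          exact j.2 (by rw [Option.some.inj hj]; exact hi)
        · rw [← hclass i (fun h => hi (by simp [hBad, h]))]
          congr 1
          refine Fintype.card_congr
            { toFun := fun x => ⟨x.1, Option.some.inj x.2⟩
              invFun := fun x => ⟨⟨x.1, by rw [x.2]; exact hi⟩, by simp only [hτ, x.2]⟩
              left_inv := fun x => rfl
              right_inv := fun x => rfl }
      rw [Finset.prod_congr rfl fun i _ => hcard i, Finset.prod_ite, Finset.prod_const_one,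
        one_mul, Finset.prod_const]
      have hB3 : Bad.card ≤ 3 := Finset.card_le_three
      have hge : k - 2 ≤ (Finset.univ.filter fun i => i ∉ Bad).card := by
        have h1 : (Finset.univ.filter fun i => i ∉ Bad) = Badᶜ := by ext; simp
        rw [h1, Finset.card_compl, Fintype.card_fin]
        omega
      exact mul_le_mul_of_nonneg_left
        (pow_le_pow_of_le_one (agreeProb_nonneg _ _) (agreeProb_le_one p ℓ) hge) p.2.1
  have hsub : {G : SimpleGraph (Fin n) | ¬ ∃ c : Fin n → Fin (k + 1), G.IsSetColoring c} ⊆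
      ⋃ x ∈ (Finset.univ : Finset (Fin n × Fin n)), {G : SimpleGraph (Fin n) | G.Adj x.1 x.2 ∧
        G.neighborColorSet c x.1 = G.neighborColorSet c x.2} := by
    intro G hG
    have h1 : ¬ G.IsSetColoring c := fun h => hG ⟨c, h⟩
    unfold IsSetColoring at h1
    push Not at h1
    obtain ⟨u, v, huv, heq⟩ := h1
    exact Set.mem_biUnion (Finset.mem_coe.2 (Finset.mem_univ (u, v))) ⟨huv, heq⟩
  refine (measureReal_mono hsub (measure_ne_top _ _)).trans
    ((measureReal_biUnion_finset_le _ _).trans ?_)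
  refine (Finset.sum_le_sum fun x _ => hpair x.1 x.2).trans (le_of_eq ?_)
  rw [Finset.sum_const, nsmul_eq_mul, Finset.card_univ, Fintype.card_prod, Fintype.card_fin]
  push_cast
  ring

end SimpleGraph

section AAS

open SimpleGraph

lemma holdsAAS_iff {p : ℕ → I} {E : (n : ℕ) → SimpleGraph (Fin n) → Prop} :
    HoldsAAS p E ↔
      Tendsto (fun n => (binomialRandom (Fin n) (p n)).real {G | ¬ E n G}) atTop (𝓝 0) := by
  have h : ∀ n, (binomialRandom (Fin n) (p n)).real {G | ¬ E n G} =
      1 - (binomialRandom (Fin n) (p n) {G | E n G}).toReal := fun n =>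
    probReal_compl_eq_one_sub (s := {G | E n G}) MeasurableSet.of_discrete
  unfold HoldsAAS
  simp_rw [h]
  rw [← ENNReal.tendsto_toReal_iff (fun n => measure_ne_top _ _) ENNReal.one_ne_top]
  constructor
  · intro h
    simpa using h.const_sub 1
  · intro h
    simpa using h.const_sub 1

lemma holdsAAS_of_eventually_le {p : ℕ → I} {E : (n : ℕ) → SimpleGraph (Fin n) → Prop}
    {b : ℕ → ℝ} (hb : Tendsto b atTop (𝓝 0))
    (h : ∀ᶠ n in atTop, (binomialRandom (Fin n) (p n)).real {G | ¬ E n G} ≤ b n) :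
    HoldsAAS p E :=
  holdsAAS_iff.2 (squeeze_zero' (Eventually.of_forall fun _ => measureReal_nonneg) h hb)

lemma HoldsAAS.mono {p : ℕ → I} {E F : (n : ℕ) → SimpleGraph (Fin n) → Prop}
    (hE : HoldsAAS p E) (h : ∀ᶠ n in atTop, ∀ G, E n G → F n G) : HoldsAAS p F :=
  holdsAAS_of_eventually_le (holdsAAS_iff.1 hE) (h.mono fun _ hn =>
    measureReal_mono fun G hG hEG => hG (hn G hEG))

lemma HoldsAAS.and {p : ℕ → I} {E F : (n : ℕ) → SimpleGraph (Fin n) → Prop}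
    (hE : HoldsAAS p E) (hF : HoldsAAS p F) : HoldsAAS p (fun n G => E n G ∧ F n G) := by
  have := (holdsAAS_iff.1 hE).add (holdsAAS_iff.1 hF)
  rw [add_zero] at this
  refine holdsAAS_of_eventually_le this (Eventually.of_forall fun n => ?_)
  refine (measureReal_mono (fun G hG => ?_)).trans (measureReal_union_le _ _)
  by_cases h : E n G
  · exact Or.inr fun h' => hG ⟨h, h'⟩
  · exact Or.inl h

/-- If a property holds a.a.s. with every fixed error `δ`, then it holds a.a.s. with some
deterministic error tending to `0`. -/
lemma exists_tendsto_zero_of_forall_holdsAAS {p : ℕ → I}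
    {F : ℝ → (n : ℕ) → SimpleGraph (Fin n) → Prop}
    (hmono : ∀ δ δ' n G, δ ≤ δ' → F δ n G → F δ' n G) (h : ∀ δ > 0, HoldsAAS p (F δ)) :
    ∃ e : ℕ → ℝ, Tendsto e atTop (𝓝 0) ∧ HoldsAAS p (fun n => F (e n) n) := by
  -- The error is the Ky Fan distance to a certain event, increased so that it exceeds an infimum.
  set S : ℕ → Set ℝ := fun n =>
    {δ | 0 ≤ δ ∧ (binomialRandom (Fin n) (p n)).real {G | ¬ F δ n G} ≤ δ} with hS
  have hbdd : ∀ n, BddBelow (S n) := fun n => ⟨0, fun δ hδ => hδ.1⟩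
  have hne : ∀ n, (S n).Nonempty := fun n => ⟨1, zero_le_one, measureReal_le_one⟩
  set e : ℕ → ℝ := fun n => sInf (S n) + 1 / ((n : ℝ) + 1) with he
  have he0 : Tendsto e atTop (𝓝 0) := by
    have h1 : Tendsto (fun n => sInf (S n)) atTop (𝓝 0) := by
      rw [Metric.tendsto_atTop']
      intro η hη
      have h2 := (holdsAAS_iff.1 (h (η / 2) (by linarith))).eventually
        (gt_mem_nhds (by linarith : (0 : ℝ) < η / 2))
      obtain ⟨N, hN⟩ := eventually_atTop.1 h2
      refine ⟨N, fun n hn => ?_⟩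
      have h3 : sInf (S n) ≤ η / 2 := csInf_le (hbdd n) ⟨by linarith, (hN n hn.le).le⟩
      have h4 : 0 ≤ sInf (S n) := le_csInf (hne n) fun δ hδ => hδ.1
      rw [Real.dist_eq, sub_zero, abs_of_nonneg h4]
      linarith
    simpa [he] using h1.add tendsto_one_div_add_atTop_nhds_zero_nat
  refine ⟨e, he0, holdsAAS_of_eventually_le he0 (Eventually.of_forall fun n => ?_)⟩
  obtain ⟨δ, hδ, hlt⟩ := exists_lt_of_csInf_lt (hne n)
    (show sInf (S n) < e n by
      have : 0 < 1 / ((n : ℝ) + 1) := by positivity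
      simp only [he]; linarith)
  refine le_trans (measureReal_mono fun G hG hF => hG (hmono _ _ n G hlt.le hF)) (hδ.2.trans hlt.le)

end AAS

/-! ### Asymptotic lower bounds -/

section LowerBounds

open SimpleGraph

lemma tendsto_log_natCast : Tendsto (fun n : ℕ => Real.log n) atTop atTop :=
  Real.tendsto_log_atTop.comp tendsto_natCast_atTop_atTop

lemma tendsto_two_div_natCast : Tendsto (fun n : ℕ => (2 : ℝ) / n) atTop (𝓝 0) :=
  tendsto_const_nhds.div_atTop tendsto_natCast_atTop_atTop

lemma tendsto_log_sq_mul_log_sq_div {p : ℕ → I}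
    (hp_lower : (fun n : ℕ => Real.log (n : ℝ) ^ 2 * Real.log ((n : ℝ) * (p n : ℝ)) ^ 2 / (n : ℝ))
      =o[atTop] (fun n : ℕ => (p n : ℝ))) :
    Tendsto (fun n : ℕ => Real.log n ^ 2 * Real.log (n * p n) ^ 2 / (n * p n : ℝ)) atTop (𝓝 0) := by
  refine hp_lower.tendsto_div_nhds_zero.congr fun n => ?_
  rw [div_div]

/-- A real bound `B n` on `χ_s` follows from excluding set colourings with a fixed number
`k ≤ B n` of colours, since set colourings with fewer colours also use at most `⌈B n⌉ - 1` colours. -/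
lemma holdsAAS_le_setChromaticNumber {p : ℕ → I} {B : ℕ → ℝ}
    (h : ∀ᶠ n : ℕ in atTop, ∀ k : ℕ, (k : ℝ) ≤ B n →
      (binomialRandom (Fin n) (p n)).real {G | ∃ c : Fin n → Fin k, G.IsSetColoring c} ≤ 2 / n) :
    HoldsAAS p (fun n G => B n ≤ G.setChromaticNumber) := by
  refine holdsAAS_of_eventually_le tendsto_two_div_natCast (h.mono fun n hn => ?_)
  rcases le_or_gt (B n) 0 with hB | hB
  · have : {G : SimpleGraph (Fin n) | ¬ B n ≤ G.setChromaticNumber} = ∅ := by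
      ext G
      simp only [Set.mem_ofPred_eq, Set.mem_empty_iff_false, iff_false, not_not]
      exact hB.trans (Nat.cast_nonneg _)
    rw [this, measureReal_empty]
    positivity
  · have hpos : 0 < ⌈B n⌉₊ := Nat.ceil_pos.2 hB
    have hk : ((⌈B n⌉₊ - 1 : ℕ) : ℝ) ≤ B n := by
      have := Nat.ceil_lt_add_one hB.le
      rw [Nat.cast_sub hpos]
      push_cast
      linarith
    refine le_trans (measureReal_mono fun G hG => ?_) (hn _ hk)
    have h1 : G.setChromaticNumber < ⌈B n⌉₊ := Nat.lt_ceil.2 (not_le.1 hG)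
    exact exists_isSetColoring_of_le (by omega)

/-- The lower bound from the number `2 ^ k` of labels. It covers the whole range of `p`: for
`np = n ^ (α + o(1))` it specialises to `(2 α + o(1)) lg n`. -/
lemma holdsAAS_logb_lower {p : ℕ → I} {ε : ℝ} (hε : 0 < ε)
    (hp_inf : Tendsto (fun n : ℕ => (n : ℝ) * (p n : ℝ)) atTop atTop)
    (hp_lower : (fun n : ℕ => Real.log (n : ℝ) ^ 2 * Real.log ((n : ℝ) * (p n : ℝ)) ^ 2 / (n : ℝ))
      =o[atTop] (fun n : ℕ => (p n : ℝ)))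
    (hp_upper : ∀ᶠ n : ℕ in atTop, (p n : ℝ) ≤ 1 - ε) :
    HoldsAAS p (fun n G => 2 * (Real.logb 2 ((n : ℝ) * (p n : ℝ)) - Real.logb 2 (Real.log (n : ℝ))
      - Real.logb 2 (Real.log ((n : ℝ) * (p n : ℝ)))) ≤ (G.setChromaticNumber : ℝ)) := by
  obtain ⟨c, hc, hbound⟩ := exists_binomialRandom_setColoring_bound hε
  have hlogd : Tendsto (fun n : ℕ => Real.log (n * p n)) atTop atTop :=
    Real.tendsto_log_atTop.comp hp_inf
  have hF := tendsto_log_sq_mul_log_sq_div hp_lower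
  have hlogn : ∀ᶠ n : ℕ in atTop, 4 * Real.log n + 1 ≤ n := by
    have h1 := (Real.isLittleO_log_id_atTop.comp_tendsto
      tendsto_natCast_atTop_atTop).tendsto_div_nhds_zero
    have h2 := h1.eventually (gt_mem_nhds (by norm_num : (0 : ℝ) < 1 / 8))
    filter_upwards [h2, eventually_ge_atTop 2] with n h2 hn
    have hn' : (2 : ℝ) ≤ n := by exact_mod_cast hn
    simp only [Function.comp, id] at h2
    rw [div_lt_iff₀ (by linarith)] at h2
    linarith
  refine holdsAAS_le_setChromaticNumber ?_
  filter_upwards [hp_upper, hp_inf.eventually_ge_atTop 3, hlogn,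
    tendsto_log_natCast.eventually_ge_atTop 1, hlogd.eventually_ge_atTop 1,
    hlogd.eventually_ge_atTop (268 / c),
    hF.eventually (gt_mem_nhds (by norm_num : (0 : ℝ) < 1 / 64)),
    hF.eventually (gt_mem_nhds (by positivity : (0 : ℝ) < c / 268)), eventually_ge_atTop 2]
    with n hpε hd3 hn4 hL1 hD1 hDc hF1 hF2 hn2
  intro k hk
  have hn0 : (0 : ℝ) < n := by exact_mod_cast (by omega : 0 < n)
  have hp0 : 0 < (p n : ℝ) := by
    by_contra hcon
    have : (n : ℝ) * p n ≤ 0 := mul_nonpos_of_nonneg_of_nonpos hn0.le (not_lt.1 hcon)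
    linarith
  have hp1 : (p n : ℝ) ≤ 1 := (p n).2.2
  set P : ℝ := (p n : ℝ) with hP
  set d : ℝ := n * P with hd
  set L := Real.log n with hL
  set D := Real.log d with hD
  have hd0 : 0 < d := by linarith
  have hPd : P = d / n := by rw [hd]; field_simp
  have hdn : d ≤ n := by rw [hd]; nlinarith
  have hDL : D ≤ L := Real.log_le_log hd0 hdn
  set s := ⌈3 * L / P⌉₊ with hs
  have hs1 : 3 * L / P ≤ s := Nat.le_ceil _
  have hs2 : (s : ℝ) ≤ 4 * L / P := by
    have h1 := Nat.ceil_lt_add_one (a := 3 * L / P) (by positivity)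
    have h2 : 1 ≤ L / P := by rw [le_div_iff₀ hp0]; linarith
    have h3 : 4 * L / P = 3 * L / P + L / P := by ring
    rw [h3]
    linarith
  -- The number of cells is at most `(d / (L D)) ^ 2`.
  have hcells : (2 : ℝ) ^ k ≤ (d / (L * D)) ^ 2 := by
    have h1 : Real.logb 2 d - Real.logb 2 L - Real.logb 2 D = Real.logb 2 (d / (L * D)) := by
      rw [Real.logb_div hd0.ne' (by positivity),
        Real.logb_mul (x := L) (y := D) (by positivity) (by positivity)]
      ring
    rw [h1] at hk
    calc (2 : ℝ) ^ k = (2 : ℝ) ^ (k : ℝ) := (Real.rpow_natCast 2 k).symm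
      _ ≤ (2 : ℝ) ^ (Real.logb 2 (d / (L * D)) * (2 : ℕ)) :=
          Real.rpow_le_rpow_of_exponent_le (by norm_num) (by push_cast; linarith)
      _ = _ := by
          rw [Real.rpow_mul_natCast (by norm_num),
            Real.rpow_logb (by norm_num) (by norm_num) (by positivity)]
  have hk4 : (k : ℝ) ≤ 4 * D := by
    have h1 : 0 ≤ Real.logb 2 L := Real.logb_nonneg (by norm_num) hL1
    have h2 : 0 ≤ Real.logb 2 D := Real.logb_nonneg (by norm_num) hD1
    have h3 : Real.logb 2 d ≤ 2 * D := by
      rw [Real.logb, div_le_iff₀ (Real.log_pos (by norm_num))]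
      have := Real.log_two_gt_d9
      nlinarith
    linarith
  have hks : 4 * ((k : ℝ) * s) ≤ 64 * (n * D * L / d) := by
    calc 4 * ((k : ℝ) * s) ≤ 4 * ((4 * D) * (4 * L / P)) := by gcongr
      _ = _ := by rw [hPd]; field_simp; ring
  rw [div_lt_iff₀ hd0] at hF1 hF2
  have hLD1 : 1 ≤ L * D := by nlinarith
  have hLDsq : L ^ 2 * D ≤ L ^ 2 * D ^ 2 := by
    gcongr
    nlinarith
  have hLDsq' : D * L ≤ L ^ 2 * D ^ 2 := by
    have : L ^ 2 * D ^ 2 = (D * L) * (L * D) := by ring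
    rw [this]
    exact le_mul_of_one_le_right (by positivity) hLD1
  refine hbound (p n) n k s (min (n * L ^ 2 * D ^ 2 / d) n / 4) hp0 hpε hn2 ?_ ?_ ?_ ?_ ?_
  · rw [div_le_iff₀ hp0] at hs1
    linarith
  · have h1 : 64 * ((n : ℝ) * D * L / d) ≤ n := by
      rw [← mul_div_assoc, div_le_iff₀ hd0]
      nlinarith
    exact_mod_cast hks.trans h1
  · have : (k : ℝ) + 1 ≤ n := by linarith
    exact_mod_cast this
  · intro τ
    refine le_trans ?_ (min_le_sum_min_of_card hp0 (by linarith : (0 : ℝ) < n / 2)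
      (seenProb_nonneg (p n) τ) (sum_seenProb (p n) τ))
    rw [Fintype.card_finset, Fintype.card_fin, ← min_div_div_right (by norm_num)]
    push_cast
    refine min_le_min ?_ (by linarith)
    calc (n : ℝ) * L ^ 2 * D ^ 2 / d / 4 = P * (n / 2) ^ 2 / (d / (L * D)) ^ 2 := by
          rw [hPd]; field_simp; ring
      _ ≤ P * (n / 2) ^ 2 / 2 ^ k := by gcongr
  -- In terms of `Λ = n D L² / d`, the entropy is at most `67 Λ`, while the exponent is at least
  -- `min (D Λ) n / 4`; the constant `268 = 4 * 67` compares the two.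
  · have hΛ : L ≤ n * D * L ^ 2 / d := by
      rw [le_div_iff₀ hd0]
      calc L * d ≤ L * n := by gcongr
        _ ≤ L * n * (L * D) := le_mul_of_one_le_right (by positivity) hLD1
        _ = _ := by ring
    have h1 : 4 * ((k : ℝ) * s) * L ≤ 64 * (n * D * L ^ 2 / d) := by
      calc 4 * ((k : ℝ) * s) * L ≤ 64 * (n * D * L / d) * L := by gcongr
        _ = _ := by ring
    have h2 : 67 * (n * D * L ^ 2 / d) ≤ c * (min (n * L ^ 2 * D ^ 2 / d) n / 4) := by
      have h3 : 268 / c * (n * D * L ^ 2 / d) ≤ min (n * L ^ 2 * D ^ 2 / d) n := by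
        refine le_min ?_ ?_
        · calc _ ≤ D * (n * D * L ^ 2 / d) := by gcongr
            _ = _ := by ring
        · have h4 : D * L ^ 2 ≤ c / 268 * d := by linarith
          calc 268 / c * (n * D * L ^ 2 / d) = 268 / c * n / d * (D * L ^ 2) := by ring
            _ ≤ 268 / c * n / d * (c / 268 * d) := by gcongr
            _ = n := by field_simp
      calc 67 * (n * D * L ^ 2 / d) = c / 4 * (268 / c * (n * D * L ^ 2 / d)) := by
            field_simp; ring
        _ ≤ c / 4 * min (n * L ^ 2 * D ^ 2 / d) n := by gcongr
        _ = _ := by ring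
    linarith

lemma minAgreeProb_pos {q : ℝ} (h0 : 0 < q) (h1 : q < 1) : 0 < minAgreeProb q := by
  obtain ⟨ℓ, hℓ⟩ := (minAgreeProb_isLeast h0 h1).1
  rw [← hℓ]
  unfold agreeProb
  nlinarith [sq_nonneg (2 * (1 - q) ^ ℓ - 1)]

lemma minAgreeProb_le {q : ℝ} (h0 : 0 < q) (h1 : q < 1) (ℓ : ℕ) :
    minAgreeProb q ≤ agreeProb q ℓ := (minAgreeProb_isLeast h0 h1).2 ⟨ℓ, rfl⟩

lemma minAgreeProb_lt_one {q : ℝ} (h0 : 0 < q) (h1 : q < 1) : minAgreeProb q < 1 := by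
  refine (minAgreeProb_le h0 h1 1).trans_lt ?_
  simp only [agreeProb, pow_one]
  nlinarith

lemma zigzag_pos {q : ℝ} (h0 : 0 < q) (h1 : q < 1) : 0 < zigzag q := by
  unfold zigzag
  have := Real.logb_pos (b := 2) (x := 1 / minAgreeProb q) (by norm_num)
    (by rw [lt_div_iff₀ (minAgreeProb_pos h0 h1)]; linarith [minAgreeProb_lt_one h0 h1])
  positivity

/-- `s(p) ^ (t r(p) lg n) = n ^ (-2 t)`, in exponential form. -/
lemma zigzag_mul_logb_mul_log {q : ℝ} (h0 : 0 < q) (h1 : q < 1) (t x : ℝ) :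
    t * (zigzag q * Real.logb 2 x) * Real.log (minAgreeProb q) = -(2 * t * Real.log x) := by
  have hneg : Real.log (minAgreeProb q) < 0 :=
    Real.log_neg (minAgreeProb_pos h0 h1) (minAgreeProb_lt_one h0 h1)
  have hl2 : Real.log 2 ≠ 0 := (Real.log_pos (by norm_num)).ne'
  unfold zigzag
  rw [Real.logb, Real.logb, one_div, Real.log_inv]
  have := hneg.ne
  field_simp

/-- For constant `p`, the bound `min (p N² β) (N √β)` on the collision exponent applies, where
`β ≥ s(p) ^ k` is the probability of agreement. -/
lemma holdsAAS_zigzag_lower {p : ℕ → I} {q : I} (hp : ∀ n, p n = q) (h0 : 0 < (q : ℝ))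
    (h1 : (q : ℝ) < 1) {δ : ℝ} (hδ : 0 < δ) :
    HoldsAAS p (fun n G => (1 - δ) * (zigzag q * Real.logb 2 n) ≤ (G.setChromaticNumber : ℝ)) := by
  obtain ⟨c, hc, hbound⟩ := exists_binomialRandom_setColoring_bound (ε := 1 - (q : ℝ)) (by linarith)
  have hr := zigzag_pos h0 h1
  set r := zigzag q with hrd
  set P : ℝ := (q : ℝ) with hP
  set a : ℝ := min (P / 4) (1 / 2) with ha
  have ha0 : 0 < a := by positivity
  have hpow : ∀ (m : ℕ) (η C : ℝ), 0 < η → 0 < C →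
      ∀ᶠ n : ℕ in atTop, Real.log n ^ m ≤ C * (n : ℝ) ^ η := by
    intro m η C hη hC
    have h := (isLittleO_log_rpow_rpow_atTop (m : ℝ) hη).bound hC
    filter_upwards [tendsto_natCast_atTop_atTop.eventually h,
      tendsto_log_natCast.eventually_ge_atTop 0] with n hn hL
    rw [Real.rpow_natCast, Real.norm_of_nonneg (by positivity),
      Real.norm_of_nonneg (by positivity)] at hn
    exact hn
  refine holdsAAS_le_setChromaticNumber ?_
  filter_upwards [tendsto_log_natCast.eventually_ge_atTop 1, eventually_ge_atTop 2,
    hpow 2 1 (P / (32 * r)) one_pos (by positivity),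
    hpow 1 1 (1 / (2 * r + 1)) one_pos (by positivity),
    hpow 3 δ (c * a / (32 * r / P + 3)) hδ (by positivity)] with n hL1 hn2 hB1 hB2 hB3
  intro k hk
  rw [hp n]
  have hn0 : (0 : ℝ) < n := by exact_mod_cast (by omega : 0 < n)
  set L := Real.log n with hL
  rw [Real.rpow_one] at hB1 hB2
  have hlogb : Real.logb 2 n ≤ 2 * L := by
    rw [Real.logb, div_le_iff₀ (Real.log_pos (by norm_num))]
    have := Real.log_two_gt_d9
    nlinarith
  have hlogb0 : 0 ≤ Real.logb 2 n :=
    Real.logb_nonneg (by norm_num) (by exact_mod_cast (by omega : 1 ≤ n))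
  have hk2 : (k : ℝ) ≤ 2 * r * L := by
    calc (k : ℝ) ≤ (1 - δ) * (r * Real.logb 2 n) := hk
      _ ≤ 1 * (r * (2 * L)) := by gcongr; linarith
      _ = _ := by ring
  set s := ⌈3 * L / P⌉₊ with hs
  have hs1 : 3 * L / P ≤ s := Nat.le_ceil _
  have hs2 : (s : ℝ) ≤ 4 * L / P := by
    have h1 := Nat.ceil_lt_add_one (a := 3 * L / P) (by positivity)
    have h2 : 1 ≤ L / P := by rw [le_div_iff₀ h0]; linarith
    have h3 : 4 * L / P = 3 * L / P + L / P := by ring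
    rw [h3]
    linarith
  have hks : 4 * ((k : ℝ) * s) ≤ 32 * r / P * L ^ 2 := by
    calc 4 * ((k : ℝ) * s) ≤ 4 * ((2 * r * L) * (4 * L / P)) := by gcongr
      _ = _ := by ring
  refine hbound q n k s (a * (n : ℝ) ^ δ) h0 (by linarith) hn2 ?_ ?_ ?_ ?_ ?_
  · rw [div_le_iff₀ h0] at hs1
    linarith
  · have h2 : 32 * r / P * L ^ 2 ≤ n := by
      calc 32 * r / P * L ^ 2 ≤ 32 * r / P * (P / (32 * r) * n) := by gcongr
        _ = n := by field_simp
    exact_mod_cast hks.trans h2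
  · have : (k : ℝ) + 1 ≤ n := by
      calc (k : ℝ) + 1 ≤ (2 * r + 1) * L ^ 1 := by rw [pow_one]; linarith
        _ ≤ (2 * r + 1) * (1 / (2 * r + 1) * n) := by gcongr
        _ = n := by field_simp
    exact_mod_cast this
  · intro τ
    have hs0 := minAgreeProb_pos h0 h1
    have hβ : Real.exp (-(2 * (1 - δ) * L)) ≤ ∑ S, seenProb q τ S ^ 2 := by
      rw [sum_seenProb_sq, ← zigzag_mul_logb_mul_log h0 h1]
      have hlog : Real.log (minAgreeProb q) ≤ 0 :=
        (Real.log_neg hs0 (minAgreeProb_lt_one h0 h1)).le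
      calc Real.exp ((1 - δ) * (zigzag q * Real.logb 2 n) * Real.log (minAgreeProb q))
          ≤ Real.exp (k * Real.log (minAgreeProb q)) :=
            Real.exp_le_exp.2 (mul_le_mul_of_nonpos_right hk hlog)
        _ = minAgreeProb q ^ k := by rw [Real.exp_nat_mul, Real.exp_log hs0]
        _ = ∏ _i : Fin k, minAgreeProb q := by simp
        _ ≤ _ := Finset.prod_le_prod (fun _ _ => hs0.le) fun i _ => minAgreeProb_le h0 h1 _
    have hβ0 := (Real.exp_pos _).trans_le hβ
    refine le_trans ?_ (min_le_sum_min_of_sum_sq (by linarith : (0 : ℝ) < n / 2)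
      (seenProb_nonneg q τ) hβ0)
    have hnδ : (n : ℝ) ^ δ = Real.exp (δ * L) := by
      rw [Real.rpow_def_of_pos hn0, mul_comm]
    have hn_exp : (n : ℝ) = Real.exp L := (Real.exp_log hn0).symm
    refine le_min ?_ ?_
    · calc a * (n : ℝ) ^ δ ≤ P / 4 * Real.exp (2 * δ * L) := by
            rw [hnδ]
            gcongr
            · exact min_le_left _ _
            · linarith
        _ = P * (n / 2) ^ 2 * Real.exp (-(2 * (1 - δ) * L)) := by
            rw [hn_exp, div_pow, ← Real.exp_nat_mul]
            have : Real.exp (2 * δ * L) =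
                Real.exp ((2 : ℕ) * L) * Real.exp (-(2 * (1 - δ) * L)) := by
              rw [← Real.exp_add]; congr 1; push_cast; ring
            rw [this]
            ring
        _ ≤ _ := by gcongr
    · have hsq : Real.exp (-((1 - δ) * L)) ≤ √(∑ S, seenProb q τ S ^ 2) := by
        refine Real.le_sqrt_of_sq_le (le_trans (le_of_eq ?_) hβ)
        rw [← Real.exp_nat_mul]
        congr 1
        push_cast
        ring
      calc a * (n : ℝ) ^ δ ≤ 1 / 2 * Real.exp (δ * L) := by
            rw [hnδ]
            gcongr
            exact min_le_right _ _
        _ = n / 2 * Real.exp (-((1 - δ) * L)) := by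
            rw [hn_exp]
            have : Real.exp (δ * L) = Real.exp L * Real.exp (-((1 - δ) * L)) := by
              rw [← Real.exp_add]; congr 1; ring
            rw [this]
            ring
        _ ≤ _ := by gcongr
  · have hL3 : L ≤ L ^ 3 := le_self_pow₀ hL1 (by norm_num)
    calc 4 * ((k : ℝ) * s) * L + 2 * L + 1 ≤ 32 * r / P * L ^ 2 * L + 2 * L ^ 3 + L ^ 3 := by
          gcongr
          linarith
      _ = (32 * r / P + 3) * L ^ 3 := by ring
      _ ≤ (32 * r / P + 3) * (c * a / (32 * r / P + 3) * (n : ℝ) ^ δ) := by gcongr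
      _ = _ := by field_simp

end LowerBounds

/-! ### Asymptotic upper bounds -/

section UpperBounds

open SimpleGraph

lemma holdsAAS_setChromaticNumber_le {p : ℕ → I} {B : ℕ → ℝ} {k ℓ : ℕ → ℕ} {b : ℕ → ℝ}
    (hℓ : ∀ᶠ n in atTop, 0 < ℓ n) (hkℓ : ∀ᶠ n in atTop, k n * ℓ n ≤ n)
    (hk : ∀ᶠ n in atTop, (k n : ℝ) + 1 ≤ B n) (hb : Tendsto b atTop (𝓝 0))
    (h : ∀ᶠ n : ℕ in atTop, (n : ℝ) ^ 2 * (p n * agreeProb (p n) (ℓ n) ^ (k n - 2)) ≤ b n) :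
    HoldsAAS p (fun n G => (G.setChromaticNumber : ℝ) ≤ B n) := by
  refine holdsAAS_of_eventually_le hb ?_
  filter_upwards [hℓ, hkℓ, hk, h] with n h1 h2 h3 h4
  have hsub : {G : SimpleGraph (Fin n) | ¬ (G.setChromaticNumber : ℝ) ≤ B n} ⊆
      {G | ¬ ∃ c : Fin n → Fin (k n + 1), G.IsSetColoring c} := by
    intro G hG hc
    refine hG (le_trans ?_ h3)
    exact_mod_cast setChromaticNumber_le hc
  exact (measureReal_mono hsub).trans
    ((binomialRandom_not_exists_isSetColoring_le (p n) h1 h2).trans h4)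

lemma tendsto_natCast_rpow_neg {η : ℝ} (hη : 0 < η) :
    Tendsto (fun n : ℕ => (n : ℝ) ^ (-η)) atTop (𝓝 0) :=
  (tendsto_rpow_neg_atTop hη).comp tendsto_natCast_atTop_atTop

/-- The exponent is written as `⌈x⌉₊ + 2 - 2` to match `k - 2` for `k = ⌈x⌉₊ + 2`. -/
lemma pow_ceil_le_exp {A x : ℝ} (hA0 : 0 < A) (hA1 : A ≤ 1) :
    A ^ (⌈x⌉₊ + 2 - 2) ≤ Real.exp (x * Real.log A) := by
  have h1 : Real.log A ≤ 0 := Real.log_nonpos hA0.le hA1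
  calc A ^ (⌈x⌉₊ + 2 - 2) = Real.exp (⌈x⌉₊ * Real.log A) := by
        rw [Real.exp_nat_mul, Real.exp_log hA0]; rfl
    _ ≤ _ := Real.exp_le_exp.2 (mul_le_mul_of_nonpos_right (Nat.le_ceil x) h1)

/-- The upper bound for constant `p`, with classes of a size `ℓ` attaining the minimum `s(p)`. -/
lemma holdsAAS_zigzag_upper {p : ℕ → I} {q : I} (hp : ∀ n, p n = q) (h0 : 0 < (q : ℝ))
    (h1 : (q : ℝ) < 1) {δ : ℝ} (hδ : 0 < δ) :
    HoldsAAS p (fun n G => (G.setChromaticNumber : ℝ) ≤ (1 + δ) * (zigzag q * Real.logb 2 n)) := by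
  obtain ⟨ℓ, hℓ⟩ := (minAgreeProb_isLeast h0 h1).1
  have hs0 := minAgreeProb_pos h0 h1
  have hs1 := minAgreeProb_lt_one h0 h1
  have hr := zigzag_pos h0 h1
  have hℓ0 : 0 < ℓ := by
    rw [Nat.pos_iff_ne_zero]
    rintro rfl
    rw [agreeProb_zero_right] at hℓ
    linarith
  have hlogb : Tendsto (fun n : ℕ => Real.logb 2 n) atTop atTop :=
    (Real.tendsto_logb_atTop (by norm_num)).comp tendsto_natCast_atTop_atTop
  have hratio : Tendsto (fun n : ℕ => Real.log n / n) atTop (𝓝 0) :=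
    (Real.isLittleO_log_id_atTop.comp_tendsto tendsto_natCast_atTop_atTop).tendsto_div_nhds_zero
  set x : ℕ → ℝ := fun n => (1 + δ / 2) * (zigzag q * Real.logb 2 n) with hx
  have hk : ∀ᶠ n : ℕ in atTop, ((⌈x n⌉₊ + 2 : ℕ) : ℝ) + 1 ≤
      (1 + δ) * (zigzag q * Real.logb 2 n) := by
    filter_upwards [hlogb.eventually_ge_atTop (8 / (δ * zigzag q)),
      hlogb.eventually_ge_atTop 0] with n hn hn0
    rw [div_le_iff₀ (by positivity)] at hn
    have := Nat.ceil_lt_add_one (a := x n) (by positivity)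
    push_cast
    simp only [hx] at this ⊢
    linarith
  refine holdsAAS_setChromaticNumber_le (k := fun n => ⌈x n⌉₊ + 2) (ℓ := fun _ => ℓ)
    (Eventually.of_forall fun _ => hℓ0) ?_ hk (tendsto_natCast_rpow_neg hδ) ?_
  · set C : ℝ := (1 + δ) * (zigzag q * 2) * ℓ with hC
    have hℓ0' : (0 : ℝ) < ℓ := by exact_mod_cast hℓ0
    have hC0 : 0 < C := by positivity
    filter_upwards [hk, hratio.eventually (gt_mem_nhds (by positivity : (0 : ℝ) < 1 / C)),
      eventually_ge_atTop 2] with n hk hn hn2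
    have hn0 : (0 : ℝ) < n := by exact_mod_cast (by omega : 0 < n)
    rw [div_lt_div_iff₀ hn0 hC0] at hn
    have hlog : Real.logb 2 n ≤ 2 * Real.log n := by
      rw [Real.logb, div_le_iff₀ (Real.log_pos (by norm_num))]
      have := Real.log_two_gt_d9
      have : 0 ≤ Real.log n := Real.log_nonneg (by exact_mod_cast (by omega : 1 ≤ n))
      nlinarith
    have : ((⌈x n⌉₊ + 2 : ℕ) : ℝ) * ℓ ≤ n := by
      calc ((⌈x n⌉₊ + 2 : ℕ) : ℝ) * ℓ ≤ (1 + δ) * (zigzag q * (2 * Real.log n)) * ℓ := by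
            gcongr
            refine le_trans ?_ (hk.trans (by gcongr))
            linarith
        _ = Real.log n * C := by rw [hC]; ring
        _ ≤ n := by linarith
    exact_mod_cast this
  · filter_upwards [eventually_ge_atTop 1] with n hn
    have hn0 : (0 : ℝ) < n := by exact_mod_cast hn
    rw [hp n, hℓ]
    calc (n : ℝ) ^ 2 * (q * minAgreeProb q ^ (⌈x n⌉₊ + 2 - 2))
        ≤ (n : ℝ) ^ 2 * (1 * Real.exp (x n * Real.log (minAgreeProb q))) := by
          gcongr
          exact pow_ceil_le_exp hs0 hs1.le
      _ = (n : ℝ) ^ (-δ) := by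
          simp only [hx]
          rw [zigzag_mul_logb_mul_log h0 h1, one_mul, Real.rpow_def_of_pos hn0]
          nth_rewrite 1 [← Real.exp_log hn0]
          rw [← Real.exp_nat_mul, ← Real.exp_add]
          congr 1
          push_cast
          ring

/-- The upper bound for `p = o(1)`, where the agreement probability can be made `1 / 2 + o(1)`. -/
lemma holdsAAS_upper_of_tendsto_zero {p : ℕ → I} {α : ℝ} (hα : 0 ≤ α)
    (hp_inf : Tendsto (fun n : ℕ => (n : ℝ) * (p n : ℝ)) atTop atTop)
    (hp_lower : (fun n : ℕ => Real.log (n : ℝ) ^ 2 * Real.log ((n : ℝ) * (p n : ℝ)) ^ 2 / (n : ℝ))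
      =o[atTop] (fun n : ℕ => (p n : ℝ)))
    (hp0 : Tendsto (fun n : ℕ => (p n : ℝ)) atTop (𝓝 0))
    (hpow : IsPowOneLittleO (fun n : ℕ => (n : ℝ) * (p n : ℝ)) α) {δ : ℝ} (hδ : 0 < δ) :
    HoldsAAS p (fun n G => (G.setChromaticNumber : ℝ) ≤ (1 + α + δ) * Real.logb 2 n) := by
  classical
  obtain ⟨e, he0, he⟩ := hpow
  have hlogb : Tendsto (fun n : ℕ => Real.logb 2 n) atTop atTop :=
    (Real.tendsto_logb_atTop (by norm_num)).comp tendsto_natCast_atTop_atTop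
  have hl2 : 0 < Real.log 2 := Real.log_pos (by norm_num)
  have hlogd : Tendsto (fun n : ℕ => Real.log (n * p n)) atTop atTop :=
    Real.tendsto_log_atTop.comp hp_inf
  have hpp : ∀ᶠ n : ℕ in atTop, 0 < (p n : ℝ) ∧ (p n : ℝ) < 1 := by
    filter_upwards [hp_inf.eventually_ge_atTop 1, hp0.eventually (gt_mem_nhds one_pos)] with n hn h1
    refine ⟨?_, h1⟩
    by_contra hcon
    have : (n : ℝ) * p n ≤ 0 := mul_nonpos_of_nonneg_of_nonpos (Nat.cast_nonneg n) (not_lt.1 hcon)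
    linarith
  have hex : ∀ n : ℕ, ∃ ℓ : ℕ, 0 < (p n : ℝ) ∧ (p n : ℝ) < 1 →
      0 < ℓ ∧ (ℓ : ℝ) ≤ 1 / p n + 1 ∧ agreeProb (p n) ℓ ≤ (1 + (p n : ℝ) ^ 2) / 2 := by
    intro n
    by_cases h : 0 < (p n : ℝ) ∧ (p n : ℝ) < 1
    · obtain ⟨ℓ, hℓ⟩ := exists_agreeProb_le h.1 h.2
      exact ⟨ℓ, fun _ => hℓ⟩
    · exact ⟨0, fun h' => absurd h' h⟩
  choose ℓ hℓ using hex
  set t : ℝ := 1 + α + δ / 2 with ht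
  have ht0 : 0 < t := by positivity
  set x : ℕ → ℝ := fun n => t * Real.logb 2 n with hx
  have hk : ∀ᶠ n : ℕ in atTop, ((⌈x n⌉₊ + 2 : ℕ) : ℝ) + 1 ≤ (1 + α + δ) * Real.logb 2 n := by
    filter_upwards [hlogb.eventually_ge_atTop (8 / δ), hlogb.eventually_ge_atTop 0] with n hn hn0
    rw [div_le_iff₀ (by positivity)] at hn
    have := Nat.ceil_lt_add_one (a := x n) (by positivity)
    push_cast
    simp only [hx, ht] at this ⊢
    linarith
  refine holdsAAS_setChromaticNumber_le (k := fun n => ⌈x n⌉₊ + 2) (ℓ := ℓ)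
    (hpp.mono fun n hn => (hℓ n hn).1) ?_ hk (tendsto_natCast_rpow_neg (by linarith : 0 < δ / 4)) ?_
  · set C : ℝ := (1 + α + δ) * 4 with hC
    have hC0 : 0 < C := by positivity
    filter_upwards [hpp, hk, (tendsto_log_sq_mul_log_sq_div hp_lower).eventually
      (gt_mem_nhds (by positivity : (0 : ℝ) < 1 / C)), hlogd.eventually_ge_atTop 1,
      tendsto_log_natCast.eventually_ge_atTop 1] with n hpn hk hF hD hL
    have hn0 : (0 : ℝ) < n := by
      rcases Nat.eq_zero_or_pos n with rfl | h
      · simp at hL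
        linarith
      · exact_mod_cast h
    have hd0 : 0 < (n : ℝ) * p n := mul_pos hn0 hpn.1
    rw [div_lt_div_iff₀ hd0 hC0] at hF
    set L := Real.log n with hLd
    set D := Real.log (n * p n) with hDd
    have hlog : Real.logb 2 n ≤ 2 * L := by
      rw [Real.logb, div_le_iff₀ hl2]
      have := Real.log_two_gt_d9
      nlinarith
    have hℓn : (ℓ n : ℝ) ≤ 2 / p n := by
      have h1 : 1 ≤ 1 / (p n : ℝ) := by rw [le_div_iff₀ hpn.1]; linarith
      have h2 : 2 / (p n : ℝ) = 1 / p n + 1 / p n := by ring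
      rw [h2]
      linarith [(hℓ n hpn).2.1]
    have hLD : L ≤ L ^ 2 * D ^ 2 := by
      have h1 : 1 ≤ L * D ^ 2 := by nlinarith
      calc L ≤ L * (L * D ^ 2) := le_mul_of_one_le_right (by linarith) h1
        _ = _ := by ring
    have : ((⌈x n⌉₊ + 2 : ℕ) : ℝ) * ℓ n ≤ n := by
      calc ((⌈x n⌉₊ + 2 : ℕ) : ℝ) * ℓ n ≤ ((1 + α + δ) * (2 * L)) * (2 / p n) := by
            gcongr
            refine le_trans ?_ (hk.trans (by gcongr))
            linarith
        _ = L * C / p n := by rw [hC]; ring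
        _ ≤ n := by
            rw [div_le_iff₀ hpn.1]
            nlinarith
    exact_mod_cast this
  · have hlim : Tendsto (fun n => e n + t * ((p n : ℝ) ^ 2 / Real.log 2)) atTop (𝓝 0) := by
      have := he0.add (((hp0.pow 2).div_const (Real.log 2)).const_mul t)
      simpa using this
    filter_upwards [hpp, he, eventually_ge_atTop 1,
      hlim.eventually (gt_mem_nhds (by linarith : (0 : ℝ) < δ / 4))] with n hpn hen hn1 hlim
    have hn0 : (0 : ℝ) < n := by exact_mod_cast hn1
    have hL0 : 0 ≤ Real.log n := Real.log_nonneg (by exact_mod_cast hn1)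
    set A : ℝ := (1 + (p n : ℝ) ^ 2) / 2 with hA
    have hA0 : 0 < A := by positivity
    have hA1 : A ≤ 1 := by
      rw [hA]
      nlinarith [hpn.1, hpn.2]
    have hlogA : Real.log A ≤ (p n : ℝ) ^ 2 - Real.log 2 := by
      rw [hA, Real.log_div (by positivity) (by norm_num)]
      have := Real.log_le_sub_one_of_pos (by positivity : 0 < 1 + (p n : ℝ) ^ 2)
      linarith
    have hx0 : 0 ≤ x n := mul_nonneg ht0.le
      (Real.logb_nonneg (by norm_num) (by exact_mod_cast hn1))
    calc (n : ℝ) ^ 2 * (p n * agreeProb (p n) (ℓ n) ^ (⌈x n⌉₊ + 2 - 2))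
        ≤ (n : ℝ) ^ 2 * (p n * Real.exp (x n * Real.log A)) := by
          gcongr
          · exact hpn.1.le
          · exact (pow_le_pow_left₀ (agreeProb_nonneg _ _) (hℓ n hpn).2.2 _).trans
              (pow_ceil_le_exp hA0 hA1)
      _ = n * ((n : ℝ) * p n) * Real.exp (x n * Real.log A) := by ring
      _ ≤ n * (n : ℝ) ^ (α + e n) * Real.exp (x n * ((p n : ℝ) ^ 2 - Real.log 2)) := by
          rw [hen]
          gcongr
      _ = Real.exp (Real.log n * (e n + t * ((p n : ℝ) ^ 2 / Real.log 2) - δ / 2)) := by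
          rw [Real.rpow_def_of_pos hn0]
          nth_rewrite 1 [← Real.exp_log hn0]
          rw [← Real.exp_add, ← Real.exp_add]
          congr 1
          simp only [hx, ht, Real.logb]
          field_simp
          ring
      _ ≤ Real.exp (Real.log n * (-(δ / 4))) := by
          gcongr
          linarith
      _ = (n : ℝ) ^ (-(δ / 4)) := by rw [Real.rpow_def_of_pos hn0]

end UpperBounds

lemma tendsto_log_log_div_log :
    Tendsto (fun n : ℕ => Real.log (Real.log n) / Real.log n) atTop (𝓝 0) :=
  (Real.isLittleO_log_id_atTop.comp_tendsto tendsto_log_natCast).tendsto_div_nhds_zero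

/-- If `np = n ^ (α + o(1))`, the iterated logarithms in the lower bound are negligible. -/
lemma tendsto_logb_lower_div {p : ℕ → I} {α : ℝ}
    (hp_inf : Tendsto (fun n : ℕ => (n : ℝ) * (p n : ℝ)) atTop atTop)
    (hpow : IsPowOneLittleO (fun n : ℕ => (n : ℝ) * (p n : ℝ)) α) :
    Tendsto (fun n : ℕ => 2 * (Real.logb 2 ((n : ℝ) * (p n : ℝ)) - Real.logb 2 (Real.log (n : ℝ))
      - Real.logb 2 (Real.log ((n : ℝ) * (p n : ℝ)))) / Real.logb 2 n) atTop (𝓝 (2 * α)) := by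
  obtain ⟨e, he0, he⟩ := hpow
  have hlogd : Tendsto (fun n : ℕ => Real.log (n * p n)) atTop atTop :=
    Real.tendsto_log_atTop.comp hp_inf
  have hl2 : Real.log 2 ≠ 0 := (Real.log_pos (by norm_num)).ne'
  have hD : Tendsto (fun n : ℕ => Real.log (Real.log (n * p n)) / Real.log n) atTop (𝓝 0) := by
    refine squeeze_zero' ?_ ?_ tendsto_log_log_div_log
    · filter_upwards [hlogd.eventually_ge_atTop 1, tendsto_log_natCast.eventually_ge_atTop 1]
        with n h1 h2
      exact div_nonneg (Real.log_nonneg h1) (by linarith)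
    · filter_upwards [hlogd.eventually_ge_atTop 1, tendsto_log_natCast.eventually_ge_atTop 1,
        hp_inf.eventually_ge_atTop 1] with n h1 h2 h3
      have h4 : (n : ℝ) * p n ≤ n := mul_le_of_le_one_right (Nat.cast_nonneg n) (p n).2.2
      gcongr
  have hd : Tendsto (fun n : ℕ => Real.log (n * p n) / Real.log n) atTop (𝓝 α) := by
    have h1 : Tendsto (fun n => α + e n) atTop (𝓝 α) := by simpa using he0.const_add α
    refine h1.congr' ?_
    filter_upwards [he, tendsto_log_natCast.eventually_ge_atTop 1, eventually_ge_atTop 1]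
      with n hn hL hn1
    rw [hn, Real.log_rpow (by exact_mod_cast hn1)]
    field_simp
  have h := ((hd.sub tendsto_log_log_div_log).sub hD).const_mul 2
  rw [sub_zero, sub_zero] at h
  refine h.congr' ?_
  filter_upwards [tendsto_log_natCast.eventually_ge_atTop 1] with n hL
  simp only [Real.logb]
  field_simp

/-! ### The set chromatic number -/

theorem theorem1p1 (p : ℕ → I) (ε : ℝ) (hε : ε ∈ Set.Ioo (0 : ℝ) 1)
    (hp_inf : Tendsto (fun n : ℕ => (n : ℝ) * (p n : ℝ)) atTop atTop)
    (hp_lower : (fun n : ℕ => Real.log (n : ℝ) ^ 2 * Real.log ((n : ℝ) * (p n : ℝ)) ^ 2 / (n : ℝ))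
      =o[atTop] (fun n : ℕ => (p n : ℝ)))
    (hp_upper : ∀ᶠ n : ℕ in atTop, (p n : ℝ) ≤ 1 - ε) :
    -- constant `p`
    (∀ q : I, (∀ n, p n = q) →
      ∃ e : ℕ → ℝ, Tendsto e atTop (𝓝 0) ∧
        HoldsAAS p (fun n G =>
          |(G.setChromaticNumber : ℝ) / (zigzag (q : ℝ) * Real.logb 2 (n : ℝ)) - 1| ≤ e n)) ∧
    -- `p = o(1)` and `np = n^{α + o(1)}` with `0 < α ≤ 1`
    (∀ α : ℝ, α ∈ Set.Ioc (0 : ℝ) 1 →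
      Tendsto (fun n : ℕ => (p n : ℝ)) atTop (𝓝 0) →
      IsPowOneLittleO (fun n : ℕ => (n : ℝ) * (p n : ℝ)) α →
      ∃ e₁ e₂ : ℕ → ℝ, Tendsto e₁ atTop (𝓝 0) ∧ Tendsto e₂ atTop (𝓝 0) ∧
        HoldsAAS p (fun n G =>
          (2 * α + e₁ n) * Real.logb 2 (n : ℝ) ≤ (G.setChromaticNumber : ℝ) ∧
          (G.setChromaticNumber : ℝ) ≤ (1 + α + e₂ n) * Real.logb 2 (n : ℝ))) ∧
    -- `np = n^{o(1)}`
    (IsPowOneLittleO (fun n : ℕ => (n : ℝ) * (p n : ℝ)) 0 →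
      ∃ e : ℕ → ℝ, Tendsto e atTop (𝓝 0) ∧
        HoldsAAS p (fun n G =>
          2 * (Real.logb 2 ((n : ℝ) * (p n : ℝ)) - Real.logb 2 (Real.log (n : ℝ))
              - Real.logb 2 (Real.log ((n : ℝ) * (p n : ℝ)))) ≤ (G.setChromaticNumber : ℝ) ∧
          (G.setChromaticNumber : ℝ) ≤ (1 + e n) * Real.logb 2 (n : ℝ))) := by
  have hnp : ∀ᶠ n : ℕ in atTop, 0 < Real.logb 2 (n : ℝ) :=
    ((Real.tendsto_logb_atTop (by norm_num)).comp
      tendsto_natCast_atTop_atTop).eventually_gt_atTop 0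
  refine ⟨?_, ?_, ?_⟩
  · intro q hq
    have h0 : 0 < (q : ℝ) := by
      obtain ⟨n, hn⟩ := (hp_inf.eventually_ge_atTop 1).exists
      rw [hq n] at hn
      by_contra hcon
      have : (n : ℝ) * q ≤ 0 := mul_nonpos_of_nonneg_of_nonpos (Nat.cast_nonneg n) (not_lt.1 hcon)
      linarith
    have h1 : (q : ℝ) < 1 := by
      obtain ⟨n, hn⟩ := hp_upper.exists
      rw [hq n] at hn
      linarith [hε.1]
    refine exists_tendsto_zero_of_forall_holdsAAS (F := fun δ n G =>
      |(G.setChromaticNumber : ℝ) / (zigzag (q : ℝ) * Real.logb 2 (n : ℝ)) - 1| ≤ δ)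
      (fun δ δ' n G h hF => hF.trans h) fun δ hδ => ?_
    refine ((holdsAAS_zigzag_lower hq h0 h1 hδ).and (holdsAAS_zigzag_upper hq h0 h1 hδ)).mono ?_
    filter_upwards [hnp] with n hn G hG
    have hpos := mul_pos (zigzag_pos h0 h1) hn
    have hl := (le_div_iff₀ hpos).2 hG.1
    have hu := (div_le_iff₀ hpos).2 hG.2
    rw [abs_le]
    constructor <;> linarith
  · intro α hα hp0 hpow
    obtain ⟨e₂, he₂, hu⟩ := exists_tendsto_zero_of_forall_holdsAAS (p := p) (F := fun δ n G =>
      (G.setChromaticNumber : ℝ) ≤ (1 + α + δ) * Real.logb 2 (n : ℝ))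
      (fun δ δ' n G h hF => hF.trans (mul_le_mul_of_nonneg_right (by linarith) (by
        rcases Nat.eq_zero_or_pos n with rfl | hn
        · simp
        · exact Real.logb_nonneg (by norm_num) (by exact_mod_cast hn))))
      fun δ hδ => holdsAAS_upper_of_tendsto_zero hα.1.le hp_inf hp_lower hp0 hpow hδ
    have he₁ := (tendsto_logb_lower_div hp_inf hpow).sub_const (2 * α)
    rw [sub_self] at he₁
    refine ⟨_, e₂, he₁, he₂, ?_⟩
    refine ((holdsAAS_logb_lower hε.1 hp_inf hp_lower hp_upper).and hu).mono ?_
    filter_upwards [hnp] with n hn G hG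
    refine ⟨le_trans (le_of_eq ?_) hG.1, hG.2⟩
    rw [add_sub_cancel, div_mul_cancel₀ _ hn.ne']
  · intro hpow
    have hp0 : Tendsto (fun n : ℕ => (p n : ℝ)) atTop (𝓝 0) := by
      obtain ⟨e, he0, he⟩ := hpow
      refine squeeze_zero' (Eventually.of_forall fun n => (p n).2.1) ?_
        (tendsto_natCast_rpow_neg (by norm_num : (0 : ℝ) < 1 / 2))
      filter_upwards [he, he0.eventually (gt_mem_nhds (by norm_num : (0 : ℝ) < 1 / 2)),
        eventually_ge_atTop 1] with n hn hlt hn1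
      have hn1' : (1 : ℝ) ≤ n := by exact_mod_cast hn1
      have hn0 : (0 : ℝ) < n := by linarith
      have h1 : (p n : ℝ) = (n : ℝ) ^ (e n - 1) := by
        rw [Real.rpow_sub_one hn0.ne', eq_div_iff hn0.ne', mul_comm, hn, zero_add]
      rw [h1]
      exact Real.rpow_le_rpow_of_exponent_le hn1' (by linarith)
    obtain ⟨e, he, hu⟩ := exists_tendsto_zero_of_forall_holdsAAS (p := p) (F := fun δ n G =>
      (G.setChromaticNumber : ℝ) ≤ (1 + δ) * Real.logb 2 (n : ℝ))
      (fun δ δ' n G h hF => hF.trans (mul_le_mul_of_nonneg_right (by linarith) (by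
        rcases Nat.eq_zero_or_pos n with rfl | hn
        · simp
        · exact Real.logb_nonneg (by norm_num) (by exact_mod_cast hn))))
      fun δ hδ => by
        simpa using holdsAAS_upper_of_tendsto_zero le_rfl hp_inf hp_lower hp0 hpow hδ
    exact ⟨e, he, (holdsAAS_logb_lower hε.1 hp_inf hp_lower hp_upper).and hu⟩
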